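/- Let $M$ be a $C^\infty$ manifold of dimension $m\ge 3$ with a $C^\infty$ torsion free affine connection $\nabla$, and let $q\in M$. Suppose that $(M,\nabla)$ is locally projectively flat around $q$, i.e. there is a diffeomorphism $\Phi$ from a neighbourhood $U$ of $q$ onto an open subset of $\mathbf R^m$ which maps the $\nabla$-geodesics in $U$, up to parametrization, to straight lines. For a $C^\infty$ curve $\gamma$ in $M$ put $\nabla\gamma=\gamma'$ and $\nabla^{k}\gamma=\nabla^{\gamma}_{\partial/\partial t}(\nabla^{k-1}\gamma)$ for $k\ge2$, where $\nabla^{\gamma}_{\partial/\partial t}$ is the covariant derivative along $\gamma$. Let $\gamma$ be a $C^\infty$ curve defined near $t_0\in\mathbf R$ with $\gamma(t_0)=q$ which is torsionless: for every $t$ near $t_0$ the vectors $(\nabla\gamma)(t),(\nabla^2\gamma)(t)$ are linearly independent and $(\nabla\gamma)(t),(\nabla^2\gamma)(t),(\nabla^3\gamma)(t)$ are linearly dependent. Let $f=\nabla\text{-Tan}(\gamma)$ be the $\nabla$-tangent surface of $\gamma$, i.e. $f(t,s)=\varphi(\gamma(t),\gamma'(t),s)$, where $s\mapsto\varphi(x,v,s)$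 is the $\nabla$-geodesic with $\varphi(x,v,0)=x$ and $\frac{\partial\varphi}{\partial s}(x,v,0)=v$. Then $f(t_0,0)=q$, and the germ $f:(\mathbf R^2,(t_0,0))\to(M,q)$ is a fold: it is $C^\infty$, and there are diffeomorphism germs $\sigma:(\mathbf R^2,(t_0,0))\to(\mathbf R^2,0)$ and $\tau:(M,q)\to(\mathbf R^m,0)$ such that $\tau\circ f=g\circ\sigma$ for $g(t,s)=(t+s,\;t^2+2st,\;0,\dots,0)$. In particular $f$ is generically two-to-one near $(t_0,0)$: every neighbourhood of $(t_0,0)$ contains an open neighbourhood $W$ of $(t_0,0)$ and an open dense subset $O$ of $W$ such that for every $z\in O$ there are exactly two points $w\in W$ with $f(w)=f(z)$. -/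

import Mathlib

open Set Filter Topology
open scoped Manifold ContDiff

noncomputable section

section AffineConnection

variable {m : ℕ} {M : Type*} [TopologicalSpace M] [ChartedSpace (EuclideanSpace ℝ (Fin m)) M]

/-- The velocity vector `γ'(t) ∈ T_{γ(t)} M` of a curve. -/
def curveVelocity (γ : ℝ → M) (t : ℝ) : TangentSpace (𝓡 m) (γ t) :=
  mfderiv 𝓘(ℝ, ℝ) (𝓡 m) γ t (1 : ℝ)

variable [IsManifold (𝓡 m) ∞ M]

/-- The covariant derivative `∇_{∂/∂t} v` of a vector field `v` along a curve `γ`.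
Let `∂_ν` be the coordinate frame of the preferred chart at `γ t`, let `v^ν` be the components of
`v` in it and let `c = v t`. The first summand is `(dv^ν/dt) ∂_ν`. The field `extend (v t)` is the
field `c^ν ∂_ν` with constant components, so the second summand is
`c^ν ∇_{γ'} ∂_ν = Γ^λ_{μν} (γ')^μ v^ν ∂_λ`. -/
def covDerivAlong
    (cov : CovariantDerivative (𝓡 m) (EuclideanSpace ℝ (Fin m)) (TangentSpace (𝓡 m) : M → Type _))
    (γ : ℝ → M) (v : ∀ t : ℝ, TangentSpace (𝓡 m) (γ t)) (t : ℝ) : TangentSpace (𝓡 m) (γ t) :=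
  (trivializationAt (EuclideanSpace ℝ (Fin m)) (TangentSpace (𝓡 m) : M → Type _) (γ t)).symm (γ t)
      (deriv (fun τ : ℝ =>
        (trivializationAt (EuclideanSpace ℝ (Fin m)) (TangentSpace (𝓡 m) : M → Type _) (γ t)
          ⟨γ τ, v τ⟩).2) t)
    + cov (FiberBundle.extend (EuclideanSpace ℝ (Fin m)) (v t)) (γ t) (curveVelocity γ t)

/-- The iterated covariant derivatives of a curve: `iterCovDeriv cov γ k` is `∇^{k+1} γ`, that is,
`γ'` for `k = 0`, `∇_{∂/∂t} γ'` for `k = 1`, and so on. -/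
def iterCovDeriv
    (cov : CovariantDerivative (𝓡 m) (EuclideanSpace ℝ (Fin m)) (TangentSpace (𝓡 m) : M → Type _))
    (γ : ℝ → M) : ℕ → ∀ t : ℝ, TangentSpace (𝓡 m) (γ t)
  | 0 => curveVelocity γ
  | k + 1 => covDerivAlong cov γ (iterCovDeriv cov γ k)

/-- `γ` is a smooth torsionless curve on `J`: at every `t ∈ J` the vectors `∇γ, ∇²γ` are linearly
independent and `∇γ, ∇²γ, ∇³γ` are linearly dependent. -/
structure IsTorsionlessOn
    (cov : CovariantDerivative (𝓡 m) (EuclideanSpace ℝ (Fin m)) (TangentSpace (𝓡 m) : M → Type _))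
    (γ : ℝ → M) (J : Set ℝ) : Prop where
  smooth : ContMDiffOn 𝓘(ℝ, ℝ) (𝓡 m) ∞ γ J
  indep : ∀ t ∈ J,
    LinearIndependent ℝ ![iterCovDeriv cov γ 0 t, iterCovDeriv cov γ 1 t]
  dep : ∀ t ∈ J,
    ¬ LinearIndependent ℝ
      ![iterCovDeriv cov γ 0 t, iterCovDeriv cov γ 1 t, iterCovDeriv cov γ 2 t]

/-- `c` is a `∇`-geodesic on `J`: it is smooth and `∇_{∂/∂s} c' = 0` on `J`. -/
structure IsGeodesicCurveOn
    (cov : CovariantDerivative (𝓡 m) (EuclideanSpace ℝ (Fin m)) (TangentSpace (𝓡 m) : M → Type _))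
    (c : ℝ → M) (J : Set ℝ) : Prop where
  smooth : ContMDiffOn 𝓘(ℝ, ℝ) (𝓡 m) ∞ c J
  geodesic : ∀ s ∈ J, covDerivAlong cov c (curveVelocity c) s = 0

/-- `c` is a `∇`-geodesic on the open interval `J`, which contains `0`, with initial point and
initial velocity given by the tangent vector `p = (x, v)`. -/
structure IsGeodesicFrom
    (cov : CovariantDerivative (𝓡 m) (EuclideanSpace ℝ (Fin m)) (TangentSpace (𝓡 m) : M → Type _))
    (p : TangentBundle (𝓡 m) M) (c : ℝ → M) (J : Set ℝ) : Prop where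
  isOpen : IsOpen J
  ordConnected : J.OrdConnected
  zero_mem : (0 : ℝ) ∈ J
  isGeodesic : IsGeodesicCurveOn cov c J
  initial : (⟨c 0, curveVelocity c 0⟩ : TangentBundle (𝓡 m) M) = p

open Classical in
/-- The geodesic map `φ(x, v, s)`, `p = (x, v)`: the value at time `s` of the `∇`-geodesic with
initial point `x` and initial velocity `v`. Where that geodesic is not defined up to time `s` the
value is `x`, by convention. -/
def geodesicMap
    (cov : CovariantDerivative (𝓡 m) (EuclideanSpace ℝ (Fin m)) (TangentSpace (𝓡 m) : M → Type _))
    (p : TangentBundle (𝓡 m) M) (s : ℝ) : M :=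
  if h : ∃ c : ℝ → M, ∃ J : Set ℝ, IsGeodesicFrom cov p c J ∧ s ∈ J then h.choose s else p.proj

/-- The `∇`-tangent surface `(t, s) ↦ φ(γ(t), γ'(t), s)` of a curve. -/
def tangentSurface
    (cov : CovariantDerivative (𝓡 m) (EuclideanSpace ℝ (Fin m)) (TangentSpace (𝓡 m) : M → Type _))
    (γ : ℝ → M) (z : ℝ × ℝ) : M :=
  geodesicMap cov ⟨γ z.1, curveVelocity γ z.1⟩ z.2

/-- `∇` is locally projectively flat around `q`: a diffeomorphism from a neighbourhood of `q` to an
open subset of Euclidean space is a projective equivalence onto its image with the standard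
connection, that is, it maps the `∇`-geodesics to straight lines up to parametrization. -/
def IsProjectivelyFlatAround
    (cov : CovariantDerivative (𝓡 m) (EuclideanSpace ℝ (Fin m)) (TangentSpace (𝓡 m) : M → Type _))
    (q : M) : Prop :=
  ∃ Φ : M → EuclideanSpace ℝ (Fin m),
    IsLocalDiffeomorphAt (𝓡 m) 𝓘(ℝ, EuclideanSpace ℝ (Fin m)) ∞ Φ q ∧
    ∃ U ∈ 𝓝 q, ∀ (c : ℝ → M) (J : Set ℝ), IsOpen J → J.OrdConnected →
      IsGeodesicCurveOn cov c J → MapsTo c J U →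
      ∃ a b : EuclideanSpace ℝ (Fin m), ∀ s ∈ J, ∃ r : ℝ, Φ (c s) = a + r • b

end AffineConnection

section Fold

/-- The model `(t, s) ↦ (t + s, t² + 2st, 0, …, 0)` of the (embedded) fold. -/
def foldModel (m : ℕ) (z : ℝ × ℝ) : EuclideanSpace ℝ (Fin m) :=
  WithLp.toLp 2 fun i : Fin m =>
    if (i : ℕ) = 0 then z.1 + z.2
    else if (i : ℕ) = 1 then z.1 ^ 2 + 2 * z.2 * z.1
    else 0

/-- The germ of `f` at `p` is a fold: it is smooth, and `τ ∘ f = foldModel ∘ σ` near `p` for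
diffeomorphism germs `σ : (ℝ², p) → (ℝ², 0)` and `τ : (M, f p) → (ℝᵐ, 0)`. -/
def IsFoldAt (m : ℕ) {M : Type*} [TopologicalSpace M]
    [ChartedSpace (EuclideanSpace ℝ (Fin m)) M] (f : ℝ × ℝ → M) (p : ℝ × ℝ) : Prop :=
  (∀ᶠ z in 𝓝 p, ContMDiffAt 𝓘(ℝ, ℝ × ℝ) (𝓡 m) ∞ f z) ∧
  ∃ (σ : ℝ × ℝ → ℝ × ℝ) (τ : M → EuclideanSpace ℝ (Fin m)),
    IsLocalDiffeomorphAt 𝓘(ℝ, ℝ × ℝ) 𝓘(ℝ, ℝ × ℝ) ∞ σ p ∧ σ p = 0 ∧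
    IsLocalDiffeomorphAt (𝓡 m) 𝓘(ℝ, EuclideanSpace ℝ (Fin m)) ∞ τ (f p) ∧ τ (f p) = 0 ∧
    ∀ᶠ z in 𝓝 p, τ (f z) = foldModel m (σ z)

/-- The germ of `f` at `p` is generically two-to-one: there are arbitrarily small open
neighbourhoods `W` of `p` such that, for all `z` in an open dense subset of `W`, the fibre of `f|_W`
through `z` has exactly two points. -/
def IsGenericallyTwoToOneAt {X Y : Type*} [TopologicalSpace X] (f : X → Y) (p : X) : Prop :=
  ∀ N ∈ 𝓝 p, ∃ W ⊆ N, IsOpen W ∧ p ∈ W ∧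
    ∃ O ⊆ W, IsOpen O ∧ W ⊆ closure O ∧ ∀ z ∈ O, {w ∈ W | f w = f z}.ncard = 2

end Fold

end

/-! In coordinates `Ψ` that straighten geodesics, `Γ(v, v)` is a multiple of `v`, and by
polarization `Γ(u, w)` lies in the span of `u` and `w`. Two things follow.
* The `∇`-tangent surface of `γ` becomes the surface `g + r g'` ruled by the tangent lines of
  `g = Ψ ∘ γ`, where `r(t, s)` is `s` up to a reparametrization of each line.
* Torsionlessness of `γ` becomes the condition that `g'''` is a combination of the independent
  vectors `g'`, `g''`, so that `g` is a plane curve with nonvanishing curvature.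

If `g` is the graph of `h`, the tangent lines lie on one side of it, and the vertical distance
`h(X + R) - h(X) - R h'(X)` has a smooth square root `β` with nonzero derivative in `R`. With `β` as
a coordinate the surface is the fold `(a + b, (a + b)² - b²) = (a + b, a² + 2ab)`. -/

section SmoothNear

/-- Germs of smooth maps: `f` is smooth on a whole neighbourhood of `a`. This is stronger than
`ContDiffAt ℝ ∞ f a`, where the neighbourhood may shrink with the order of differentiability. -/
def SmoothNear {E F : Type*} [NormedAddCommGroup E] [NormedSpace ℝ E] [NormedAddCommGroup F]
    [NormedSpace ℝ F] (f : E → F) (a : E) : Prop :=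
  ∀ᶠ z in 𝓝 a, ContDiffAt ℝ ∞ f z

namespace SmoothNear

variable {E F G : Type*} [NormedAddCommGroup E] [NormedSpace ℝ E] [NormedAddCommGroup F]
    [NormedSpace ℝ F] [NormedAddCommGroup G] [NormedSpace ℝ G] {f g : E → F} {a : E}

lemma contDiffAt (hf : SmoothNear f a) : ContDiffAt ℝ ∞ f a := hf.self_of_nhds

lemma continuousAt (hf : SmoothNear f a) : ContinuousAt f a := hf.contDiffAt.continuousAt

lemma differentiableAt (hf : SmoothNear f a) : DifferentiableAt ℝ f a :=
  hf.contDiffAt.differentiableAt (by simp)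

lemma eventually (hf : SmoothNear f a) : ∀ᶠ z in 𝓝 a, SmoothNear f z :=
  eventually_eventually_nhds.2 hf

lemma of_contDiff (hf : ContDiff ℝ ∞ f) : SmoothNear f a :=
  .of_forall fun _ => hf.contDiffAt

lemma of_contDiffOn {s : Set E} (hf : ContDiffOn ℝ ∞ f s) (hs : IsOpen s) (ha : a ∈ s) :
    SmoothNear f a := by
  filter_upwards [hs.mem_nhds ha] with z hz using hf.contDiffAt (hs.mem_nhds hz)

lemma congr (hf : SmoothNear f a) (hg : g =ᶠ[𝓝 a] f) : SmoothNear g a := by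
  filter_upwards [hf, hg.eventuallyEq_nhds] with z hfz hgz using hfz.congr_of_eventuallyEq hgz

lemma comp {h : F → G} (a : E) (hh : SmoothNear h (f a)) (hf : SmoothNear f a) :
    SmoothNear (fun x => h (f x)) a := by
  filter_upwards [hf, hf.continuousAt.eventually hh] with z hfz hhz using hhz.comp z hfz

lemma prodMk {h : E → G} (hf : SmoothNear f a) (hh : SmoothNear h a) :
    SmoothNear (fun x => (f x, h x)) a := by
  filter_upwards [hf, hh] with z hfz hhz using hfz.prodMk hhz

lemma add (hf : SmoothNear f a) (hg : SmoothNear g a) : SmoothNear (fun x => f x + g x) a := by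
  filter_upwards [hf, hg] with z hfz hgz using hfz.add hgz

lemma sub (hf : SmoothNear f a) (hg : SmoothNear g a) : SmoothNear (fun x => f x - g x) a := by
  filter_upwards [hf, hg] with z hfz hgz using hfz.sub hgz

lemma smul {c : E → ℝ} (hc : SmoothNear c a) (hf : SmoothNear f a) :
    SmoothNear (fun x => c x • f x) a := by
  filter_upwards [hc, hf] with z hcz hfz using hcz.smul hfz

lemma mul {c d : E → ℝ} (hc : SmoothNear c a) (hd : SmoothNear d a) :
    SmoothNear (fun x => c x * d x) a :=
  hc.smul hd

protected lemma fderiv (hf : SmoothNear f a) : SmoothNear (fderiv ℝ f) a := by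
  filter_upwards [hf] with z hz using hz.fderiv_right (by simp)

protected lemma deriv {f : ℝ → F} {a : ℝ} (hf : SmoothNear f a) : SmoothNear (deriv f) a := by
  filter_upwards [hf] with z hz
  exact (hz.fderiv_right (m := ∞) (by simp)).clm_apply contDiffAt_const

lemma exists_openPartialHomeomorph [CompleteSpace E] (hf : SmoothNear f a) {e : E ≃L[ℝ] F}
    (he : HasFDerivAt f (e : E →L[ℝ] F) a) :
    ∃ h : OpenPartialHomeomorph E F, a ∈ h.source ∧ (∀ x, h x = f x) ∧
      ContDiffOn ℝ ∞ h h.source ∧ ContDiffOn ℝ ∞ h.symm h.target := by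
  have hev : ∀ᶠ z in 𝓝 a, SmoothNear f z ∧
      fderiv ℝ f z ∈ range ((↑) : (E ≃L[ℝ] F) → E →L[ℝ] F) := by
    refine hf.eventually.and (hf.fderiv.continuousAt.eventually ?_)
    rw [he.fderiv]
    exact ContinuousLinearEquiv.nhds e
  obtain ⟨S, hS, hSo, haS⟩ := eventually_nhds_iff.1 hev
  let h := (hf.contDiffAt.toOpenPartialHomeomorph f he (by simp)).restrOpen S hSo
  refine ⟨h, ⟨hf.contDiffAt.mem_toOpenPartialHomeomorph_source he (by simp), haS⟩, fun x => rfl,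
    fun x hx => (hS x hx.2).1.contDiffAt.contDiffWithinAt, fun y hy => ?_⟩
  obtain ⟨hx, e', he'⟩ := hS _ (h.map_target hy).2
  refine (h.contDiffAt_symm hy (f₀' := e') ?_ hx.contDiffAt).contDiffWithinAt
  exact he' ▸ hx.differentiableAt.hasFDerivAt

end SmoothNear

end SmoothNear

section ParametricIntegral

universe u

variable {E F : Type u} [NormedAddCommGroup E] [NormedSpace ℝ E] [NormedAddCommGroup F]
    [NormedSpace ℝ F] {W : Set (E × ℝ)}

lemma hasFDerivAt_integral_unitInterval {k : E × ℝ → F} (hW : IsOpen W) (hk : ContDiffOn ℝ ∞ k W)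
    {z : E} (hz : ∀ θ ∈ Icc (0 : ℝ) 1, (z, θ) ∈ W) :
    HasFDerivAt (fun z => ∫ θ in (0 : ℝ)..1, k (z, θ))
      (∫ θ in (0 : ℝ)..1, (fderiv ℝ k (z, θ)).comp (ContinuousLinearMap.inl ℝ E ℝ)) z := by
  let k' : E × ℝ → E →L[ℝ] F := fun p => (fderiv ℝ k p).comp (ContinuousLinearMap.inl ℝ E ℝ)
  have hk' : ContinuousOn k' W :=
    (hk.continuousOn_fderiv_of_isOpen hW (by simp)).clm_comp continuousOn_const
  have hzW : {z} ×ˢ Icc (0 : ℝ) 1 ⊆ W := by rintro ⟨_, θ⟩ ⟨rfl, hθ⟩; exact hz θ hθ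
  obtain ⟨C, hC⟩ := (isCompact_singleton.prod isCompact_Icc).exists_bound_of_continuousOn
    (hk'.mono hzW)
  have hWC : IsOpen (W ∩ k' ⁻¹' Metric.ball 0 (C + 1)) := hk'.isOpen_inter_preimage hW
    Metric.isOpen_ball
  obtain ⟨U, V, hU, -, hzU, hV, hUV⟩ := generalized_tube_lemma isCompact_singleton isCompact_Icc
    hWC (s := {z}) (t := Icc (0 : ℝ) 1)
    fun p hp => ⟨hzW hp, mem_ball_zero_iff.2 ((hC p hp).trans_lt (lt_add_one C))⟩
  have hUW : ∀ x ∈ U, MapsTo (fun θ : ℝ => (x, θ)) (Icc 0 1) W :=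
    fun x hx θ hθ => (hUV ⟨hx, hV hθ⟩).1
  have hUk : ∀ x ∈ U, ContinuousOn (fun θ => k (x, θ)) (Icc 0 1) :=
    fun x hx => hk.continuousOn.comp (by fun_prop) (hUW x hx)
  have hz' : ContinuousOn (fun θ => k' (z, θ)) (Icc 0 1) :=
    hk'.comp (by fun_prop) (hUW z (hzU rfl))
  have huIoc : uIoc (0 : ℝ) 1 ⊆ Icc 0 1 := uIoc_subset_uIcc.trans (uIcc_of_le zero_le_one).subset
  have hUz := hU.mem_nhds (hzU rfl)
  refine intervalIntegral.hasFDerivAt_integral_of_dominated_of_fderiv_le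
    (F' := fun z θ => k' (z, θ)) (bound := fun _ => C + 1) hUz
    (by filter_upwards [hUz] with x hx using
      ((hUk x hx).mono huIoc).aestronglyMeasurable measurableSet_uIoc)
    ((hUk z (hzU rfl)).intervalIntegrable_of_Icc zero_le_one)
    ((hz'.mono huIoc).aestronglyMeasurable measurableSet_uIoc)
    (.of_forall fun θ hθ x hx => (mem_ball_zero_iff.1 (hUV ⟨hx, hV (huIoc hθ)⟩).2).le)
    intervalIntegrable_const (.of_forall fun θ hθ x hx => ?_)
  have hkx := (hk.contDiffAt (hW.mem_nhds (hUW x hx (huIoc hθ)))).differentiableAt (by simp)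
  exact hkx.hasFDerivAt.comp x (hasFDerivAt_prodMk_left x θ)

lemma contDiffOn_nat_integral_unitInterval (hW : IsOpen W) {U : Set E} (hU : IsOpen U)
    (hUW : U ×ˢ Icc (0 : ℝ) 1 ⊆ W) (n : ℕ) :
    ∀ {F : Type u} [NormedAddCommGroup F] [NormedSpace ℝ F] {k : E × ℝ → F}, ContDiffOn ℝ ∞ k W →
      ContDiffOn ℝ n (fun z => ∫ θ in (0 : ℝ)..1, k (z, θ)) U := by
  induction n with
  | zero =>
    intro F _ _ k hk
    exact contDiffOn_zero.2 fun z hz => (hasFDerivAt_integral_unitInterval hW hk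
      fun θ hθ => hUW ⟨hz, hθ⟩).continuousAt.continuousWithinAt
  | succ n ih =>
    intro F _ _ k hk
    have hderiv := fun z (hz : z ∈ U) => hasFDerivAt_integral_unitInterval hW hk
      fun θ hθ => hUW ⟨hz, hθ⟩
    have hk' : ContDiffOn ℝ ∞ (fun p => (fderiv ℝ k p).comp (ContinuousLinearMap.inl ℝ E ℝ)) W :=
      (hk.fderiv_of_isOpen hW (by simp)).clm_comp contDiffOn_const
    push_cast
    rw [contDiffOn_succ_iff_fderiv_of_isOpen hU]
    exact ⟨fun z hz => (hderiv z hz).differentiableAt.differentiableWithinAt, by simp,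
      (ih hk').congr fun z hz => (hderiv z hz).fderiv⟩

lemma SmoothNear.integral {k : E × ℝ → F} {z : E}
    (hk : ∀ θ ∈ Icc (0 : ℝ) 1, SmoothNear k (z, θ)) :
    SmoothNear (fun z => ∫ θ in (0 : ℝ)..1, k (z, θ)) z := by
  have hW : IsOpen {p | SmoothNear k p} := isOpen_setOfPred_eventually_nhds
  obtain ⟨U, V, hU, -, hzU, hV, hUV⟩ := generalized_tube_lemma isCompact_singleton isCompact_Icc hW
    (s := {z}) (t := Icc (0 : ℝ) 1) (by rintro ⟨_, θ⟩ ⟨rfl, hθ⟩; exact hk θ hθ)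
  exact of_contDiffOn (contDiffOn_infty.2 fun n => contDiffOn_nat_integral_unitInterval hW hU
    ((prod_mono subset_rfl hV).trans hUV) n
    fun p hp => hp.contDiffAt.contDiffWithinAt) hU (hzU rfl)

end ParametricIntegral

section Coordinates

open VectorField

variable {m : ℕ} {M : Type*} [TopologicalSpace M] [ChartedSpace (EuclideanSpace ℝ (Fin m)) M]

local notation "𝔼" => EuclideanSpace ℝ (Fin m)

variable (m M) in
/-- A coordinate system on an open subset of `M`. It need not belong to the given atlas, since the
coordinates that straighten geodesics do not. -/
abbrev SmoothChart : Type _ := PartialDiffeomorph (𝓡 m) 𝓘(ℝ, 𝔼) M 𝔼 ∞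

lemma mlieBracket_const {E : Type*} [NormedAddCommGroup E] [NormedSpace ℝ E] (v w x : E) :
    mlieBracket 𝓘(ℝ, E) (fun _ : E => (v : E)) (fun _ : E => (w : E)) x = 0 := by
  refine (congrFun (mlieBracketWithin_univ (I := 𝓘(ℝ, E))).symm x).trans
    ((congrFun mlieBracketWithin_eq_lieBracketWithin x).trans ?_)
  have hzero : ∀ e : E, fderivWithin ℝ (fun _ : E => e) univ x = 0 := fun e =>
    fderivWithin_const_apply e
  exact (congrArg₂ (fun A B : E →L[ℝ] E => A v - B w) (hzero w) (hzero v)).trans (sub_self 0)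

namespace SmoothChart

variable (Ψ : SmoothChart m M) {x : M}

lemma contMDiffAt (hx : x ∈ Ψ.source) : ContMDiffAt (𝓡 m) 𝓘(ℝ, 𝔼) ∞ Ψ x :=
  (Ψ.contMDiffOn x hx).contMDiffAt (Ψ.open_source.mem_nhds hx)

lemma contMDiffAt_symm {y : 𝔼} (hy : y ∈ Ψ.target) : ContMDiffAt 𝓘(ℝ, 𝔼) (𝓡 m) ∞ Ψ.symm y :=
  (Ψ.symm.contMDiffOn y hy).contMDiffAt (Ψ.open_target.mem_nhds hy)

lemma symm_apply_apply (hx : x ∈ Ψ.source) : Ψ.symm (Ψ x) = x := Ψ.left_inv hx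

/-- The differential `dΨ_x : T_x M → ℝᵐ`: it sends a tangent vector to its components. -/
noncomputable def differential (x : M) : TangentSpace (𝓡 m) x →L[ℝ] 𝔼 :=
  mfderiv (𝓡 m) 𝓘(ℝ, 𝔼) Ψ x

lemma isInvertible_differential (hx : x ∈ Ψ.source) : (Ψ.differential x).IsInvertible :=
  ⟨(Ψ.isLocalDiffeomorphAt (n := ∞) (𝓡 m) 𝓘(ℝ, 𝔼) hx).mfderivToContinuousLinearEquiv (by simp), rfl⟩

/-- The vector field on `Ψ.source` with constant components `e`. -/
noncomputable def constField (e : 𝔼) : ∀ x : M, TangentSpace (𝓡 m) x :=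
  mpullback (𝓡 m) 𝓘(ℝ, 𝔼) Ψ fun _ => e

lemma differential_constField (hx : x ∈ Ψ.source) (e : 𝔼) :
    Ψ.differential x (Ψ.constField e x) = e :=
  (Ψ.isInvertible_differential hx).self_apply_inverse _

/-- The coordinate field `∂ᵢ`. -/
noncomputable def coordField (i : Fin m) : ∀ x : M, TangentSpace (𝓡 m) x :=
  Ψ.constField (EuclideanSpace.basisFun (Fin m) ℝ i)

lemma eq_sum_coordField (hx : x ∈ Ψ.source) (v : TangentSpace (𝓡 m) x) :
    v = ∑ i, Ψ.differential x v i • Ψ.coordField i x := by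
  apply (Ψ.isInvertible_differential hx).injective
  simp_rw [map_sum, map_smul, coordField, Ψ.differential_constField hx]
  exact ((EuclideanSpace.basisFun (Fin m) ℝ).sum_repr _).symm

variable [IsManifold (𝓡 m) ∞ M]

lemma contMDiffAt_constField (hx : x ∈ Ψ.source) (e : 𝔼) :
    ContMDiffAt (𝓡 m) ((𝓡 m).prod 𝓘(ℝ, 𝔼)) ∞
      (fun x => (⟨x, Ψ.constField e x⟩ : TangentBundle (𝓡 m) M)) x :=
  ContMDiffAt.mpullback_vectorField_preimage (n := ∞)
    (contMDiffAt_vectorSpace_iff_contDiffAt.2 contDiffAt_const) (Ψ.contMDiffAt hx)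
    (Ψ.isInvertible_differential hx) (by simp)

lemma mdifferentiableAt_constField (hx : x ∈ Ψ.source) (e : 𝔼) :
    MDifferentiableAt (𝓡 m) ((𝓡 m).prod 𝓘(ℝ, 𝔼))
      (fun x => (⟨x, Ψ.constField e x⟩ : TangentBundle (𝓡 m) M)) x :=
  (Ψ.contMDiffAt_constField hx e).mdifferentiableAt (by simp)

lemma mlieBracket_constField (hx : x ∈ Ψ.source) (v w : 𝔼) :
    mlieBracket (𝓡 m) (Ψ.constField v) (Ψ.constField w) x = 0 := by
  have : IsManifold (𝓡 m) (minSmoothness ℝ 3) M := by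
    rw [minSmoothness_of_isRCLikeNormedField]
    infer_instance
  have hconst : ∀ e : 𝔼, MDifferentiableAt 𝓘(ℝ, 𝔼) (𝓘(ℝ, 𝔼).prod 𝓘(ℝ, 𝔼))
      (fun y : 𝔼 => (⟨y, e⟩ : TangentBundle 𝓘(ℝ, 𝔼) 𝔼)) (Ψ x) := fun e =>
    (contMDiffAt_vectorSpace_iff_contDiffAt.2 contDiffAt_const).mdifferentiableAt one_ne_zero
  have hpull := mpullback_mlieBracket (I := 𝓡 m) (n := ∞) (hconst v) (hconst w) (Ψ.contMDiffAt hx)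
    (by simpa only [minSmoothness_of_isRCLikeNormedField] using ENat.LEInfty.out)
  rw [constField, constField, ← hpull, mpullback_apply, mlieBracket_const, map_zero]

/-- The differential of `Ψ` in the trivialization of the tangent bundle at `x₀`. -/
noncomputable def trivializedDifferential (x₀ x : M) : 𝔼 →L[ℝ] 𝔼 :=
  (Ψ.differential x).comp
    ((trivializationAt 𝔼 (TangentSpace (𝓡 m) : M → Type _) x₀).symmL ℝ x)

lemma trivializedDifferential_apply {x₀ : M}
    (hx : x ∈ (trivializationAt 𝔼 (TangentSpace (𝓡 m) : M → Type _) x₀).baseSet)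
    (v : TangentSpace (𝓡 m) x) :
    Ψ.trivializedDifferential x₀ x
      (trivializationAt 𝔼 (TangentSpace (𝓡 m) : M → Type _) x₀ ⟨x, v⟩).2 = Ψ.differential x v := by
  rw [← Bundle.Trivialization.continuousLinearMapAt_apply_of_mem ℝ _ hx]
  exact congrArg _ (Bundle.Trivialization.symmL_continuousLinearMapAt _ hx v)

lemma differential_trivializationAt_symm {x₀ : M}
    (hx : x ∈ (trivializationAt 𝔼 (TangentSpace (𝓡 m) : M → Type _) x₀).baseSet) (e : 𝔼) :
    Ψ.differential x ((trivializationAt 𝔼 (TangentSpace (𝓡 m) : M → Type _) x₀).symm x e) =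
      Ψ.trivializedDifferential x₀ x e :=
  congrArg (Ψ.differential x) (Bundle.Trivialization.symmL_apply _ hx e).symm

lemma contMDiffAt_trivializedDifferential (hx : x ∈ Ψ.source) :
    ContMDiffAt (𝓡 m) 𝓘(ℝ, 𝔼 →L[ℝ] 𝔼) ∞ (Ψ.trivializedDifferential x) x := by
  refine ((Ψ.contMDiffAt hx).mfderiv_const (m := ∞) (by simp)).congr_of_eventuallyEq
    (.of_forall fun y => ?_)
  ext1 w
  exact (DFunLike.congr_fun
    (TangentBundle.continuousLinearMapAt_model_space (𝕜 := ℝ) (Ψ x) (Ψ y)) _).symm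

lemma isInvertible_trivializedDifferential (hx : x ∈ Ψ.source) :
    (Ψ.trivializedDifferential x x).IsInvertible :=
  (Ψ.isInvertible_differential hx).comp
    ⟨((trivializationAt 𝔼 (TangentSpace (𝓡 m) : M → Type _) x).continuousLinearEquivAt ℝ x
      (FiberBundle.mem_baseSet_trivializationAt' x)).symm,
      Bundle.Trivialization.symm_continuousLinearEquivAt_eq' ..⟩

lemma contMDiffAt_differential_apply (hx : x ∈ Ψ.source) {Z : ∀ x : M, TangentSpace (𝓡 m) x}
    (hZ : ContMDiffAt (𝓡 m) ((𝓡 m).prod 𝓘(ℝ, 𝔼)) ∞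
      (fun x => (⟨x, Z x⟩ : TangentBundle (𝓡 m) M)) x) :
    ContMDiffAt (𝓡 m) 𝓘(ℝ, 𝔼) ∞ (fun x => Ψ.differential x (Z x)) x := by
  refine ((Ψ.contMDiffAt_trivializedDifferential hx).clm_apply
    ((Bundle.contMDiffAt_section _).1 hZ)).congr_of_eventuallyEq ?_
  filter_upwards [(trivializationAt 𝔼 (TangentSpace (𝓡 m) : M → Type _) x).open_baseSet.mem_nhds
    (FiberBundle.mem_baseSet_trivializationAt' x)] with y hy
  exact (Ψ.trivializedDifferential_apply hy _).symm

end SmoothChart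

end Coordinates

section CovariantDerivative

open Bundle

variable {E : Type*} [NormedAddCommGroup E] [NormedSpace ℝ E]
  {H : Type*} [TopologicalSpace H] {I : ModelWithCorners ℝ E H}
  {M : Type*} [TopologicalSpace M] [ChartedSpace H M]
  {F : Type*} [NormedAddCommGroup F] [NormedSpace ℝ F]
  {V : M → Type*} [TopologicalSpace (TotalSpace F V)]
  [∀ x, AddCommGroup (V x)] [∀ x, Module ℝ (V x)] [∀ x : M, TopologicalSpace (V x)]
  [∀ x, IsTopologicalAddGroup (V x)] [∀ x, ContinuousSMul ℝ (V x)]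
  [FiberBundle F V] [VectorBundle ℝ F V]

lemma covariantDerivative_sum_smul {ι : Type*} (cov : CovariantDerivative I F V) (S : Finset ι)
    {s : ι → M → ℝ} {X : ι → ∀ x : M, V x} {x : M} (hs : ∀ i, MDiffAt (s i) x)
    (hX : ∀ i, MDiffAt (T% (X i)) x) :
    cov (fun y => ∑ i ∈ S, s i y • X i y) x =
      ∑ i ∈ S, (s i x • cov (X i) x + (d% (s i) x).smulRight (X i x)) := by
  classical
  induction S using Finset.induction_on with
  | empty =>
    simp only [Finset.sum_empty]
    exact congrFun cov.zero x
  | insert a S ha ih =>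
    have hsplit : (fun y => ∑ i ∈ insert a S, s i y • X i y) =
        (s a • X a) + fun y => ∑ i ∈ S, s i y • X i y :=
      funext fun y => Finset.sum_insert ha
    have hadd := cov.isCovariantDerivativeOnUniv.add ((hs a).smul_section (hX a))
      (MDifferentiableAt.sum_section (t := fun i => s i • X i) (s := S)
        fun i _ => (hs i).smul_section (hX i))
    rw [hsplit, Finset.sum_insert ha, ← ih,
      ← cov.isCovariantDerivativeOnUniv.leibniz (hX a) (hs a)]
    exact hadd

end CovariantDerivative

lemma differentiableAt_of_clm_apply {D E F : Type*} [NormedAddCommGroup D] [NormedSpace ℝ D]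
    [NormedAddCommGroup E] [NormedSpace ℝ E] [CompleteSpace E] [NormedAddCommGroup F]
    [NormedSpace ℝ F] {A : D → E →L[ℝ] F} {w : D → E} {t : D} (hA : DifferentiableAt ℝ A t)
    (hAt : (A t).IsInvertible) (hAw : DifferentiableAt ℝ (fun τ => A τ (w τ)) t) :
    DifferentiableAt ℝ w t := by
  have hinv : ∀ᶠ τ in 𝓝 t, (A τ).IsInvertible := by
    obtain ⟨e, he⟩ := hAt
    exact hA.continuousAt.eventually (he ▸ ContinuousLinearEquiv.nhds e)
  have hAinv : DifferentiableAt ℝ (fun τ => (A τ).inverse) t :=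
    (hAt.contDiffAt_map_inverse (n := 1)).differentiableAt one_ne_zero |>.comp t hA
  refine (hAinv.clm_apply hAw).congr_of_eventuallyEq ?_
  filter_upwards [hinv] with τ hτ using (hτ.inverse_apply_self _).symm

section Christoffel

variable {m : ℕ} {M : Type*} [TopologicalSpace M] [ChartedSpace (EuclideanSpace ℝ (Fin m)) M]
  [IsManifold (𝓡 m) ∞ M]

local notation "𝔼" => EuclideanSpace ℝ (Fin m)

namespace SmoothChart

variable (Ψ : SmoothChart m M)
  (cov : CovariantDerivative (𝓡 m) (EuclideanSpace ℝ (Fin m))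
    (TangentSpace (𝓡 m) : M → Type _)) {x : M}

/-- The components `(Γ^λ_{ij})_λ` of `∇_{∂ᵢ} ∂ⱼ`, as functions on the range of the coordinates. -/
noncomputable def christoffelSymbol (i j : Fin m) (y : 𝔼) : 𝔼 :=
  Ψ.differential (Ψ.symm y) (cov (Ψ.coordField j) (Ψ.symm y) (Ψ.coordField i (Ψ.symm y)))

lemma christoffelSymbol_apply_self (hx : x ∈ Ψ.source) (i j : Fin m) :
    Ψ.christoffelSymbol cov i j (Ψ x) =
      Ψ.differential x (cov (Ψ.coordField j) x (Ψ.coordField i x)) := by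
  rw [christoffelSymbol, Ψ.symm_apply_apply hx]

/-- The Christoffel symbols assembled into the bilinear map
`(u, w) ↦ (Γ^λ_{ij}(y) uⁱ wʲ)_λ`. -/
noncomputable def christoffel (y : 𝔼) : 𝔼 →L[ℝ] 𝔼 →L[ℝ] 𝔼 :=
  ∑ i, ∑ j, (EuclideanSpace.proj i : 𝔼 →L[ℝ] ℝ).smulRight
    ((EuclideanSpace.proj j : 𝔼 →L[ℝ] ℝ).smulRight (Ψ.christoffelSymbol cov i j y))

lemma christoffel_apply (y u w : 𝔼) :
    Ψ.christoffel cov y u w = ∑ i, ∑ j, (u i * w j) • Ψ.christoffelSymbol cov i j y := by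
  simp [christoffel, mul_smul]

lemma christoffelSymbol_comm (htorsion : cov.torsion = 0) {y : 𝔼} (hy : y ∈ Ψ.target)
    (i j : Fin m) : Ψ.christoffelSymbol cov i j y = Ψ.christoffelSymbol cov j i y := by
  have hx : Ψ.symm y ∈ Ψ.source := Ψ.map_target hy
  have hcoord : ∀ k, MDifferentiableAt (𝓡 m) ((𝓡 m).prod 𝓘(ℝ, 𝔼))
      (fun x => (⟨x, Ψ.coordField k x⟩ : TangentBundle (𝓡 m) M)) (Ψ.symm y) :=
    fun k => Ψ.mdifferentiableAt_constField hx _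
  exact congrArg _ (sub_eq_zero.1 ((cov.torsion_eq_zero_iff.1 htorsion (hcoord i) (hcoord j)).trans
    (Ψ.mlieBracket_constField hx _ _)))

lemma christoffel_comm (htorsion : cov.torsion = 0) {y : 𝔼} (hy : y ∈ Ψ.target) (u w : 𝔼) :
    Ψ.christoffel cov y u w = Ψ.christoffel cov y w u := by
  rw [christoffel_apply, christoffel_apply, Finset.sum_comm]
  simp_rw [Ψ.christoffelSymbol_comm cov htorsion hy, mul_comm]

/-- The connection only acts on global fields, so `∂ⱼ` is first cut off by a bump function. -/
lemma contMDiffAt_cov_coordField [T2Space M]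
    [hcov : CovariantDerivative.ContMDiffCovariantDerivative cov ∞] (hx : x ∈ Ψ.source)
    (i j : Fin m) :
    ContMDiffAt (𝓡 m) ((𝓡 m).prod 𝓘(ℝ, 𝔼)) ∞ (fun x => (⟨x,
      cov (Ψ.coordField j) x (Ψ.coordField i x)⟩ : TangentBundle (𝓡 m) M)) x := by
  obtain ⟨f, -, hf⟩ := (SmoothBumpFunction.nhds_basis_tsupport (I := 𝓡 m) x).mem_iff.1
    (Ψ.open_source.mem_nhds hx)
  let X : ∀ x : M, TangentSpace (𝓡 m) x := (f : M → ℝ) • Ψ.coordField j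
  have hX : ContMDiff (𝓡 m) ((𝓡 m).prod 𝓘(ℝ, 𝔼)) ∞
      (fun x => (⟨x, X x⟩ : TangentBundle (𝓡 m) M)) :=
    ContMDiffOn.smul_section_of_tsupport f.contMDiff.contMDiffOn Ψ.open_source hf
      fun y hy => (Ψ.contMDiffAt_constField hy _).contMDiffWithinAt
  have hcovX := (hcov.contMDiff.contMDiff (σ := X) (by simpa using hX.contMDiffOn) x
    (mem_univ x)).contMDiffAt univ_mem
  refine (hcovX.clm_bundle_apply (Ψ.contMDiffAt_constField hx
    (EuclideanSpace.basisFun (Fin m) ℝ i))).congr_of_eventuallyEq ?_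
  filter_upwards [eventually_eventually_nhds.2 f.eventuallyEq_one, Ψ.open_source.mem_nhds hx]
    with y hfy hy
  have hgerm : ∀ᶠ z in 𝓝 y, Ψ.coordField j z = X z := by
    filter_upwards [hfy] with z hz
    simp [X, hz]
  exact congrArg (fun D : TangentSpace (𝓡 m) y →L[ℝ] TangentSpace (𝓡 m) y =>
      (⟨y, D (Ψ.coordField i y)⟩ : TangentBundle (𝓡 m) M))
    (cov.isCovariantDerivativeOnUniv.congr_of_eventuallyEq
      (Ψ.mdifferentiableAt_constField hy _) (hX.mdifferentiable (by simp) y) univ_mem hgerm)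

lemma contDiffAt_christoffel [T2Space M]
    [CovariantDerivative.ContMDiffCovariantDerivative cov ∞] {y : 𝔼} (hy : y ∈ Ψ.target) :
    ContDiffAt ℝ ∞ (Ψ.christoffel cov) y := by
  have hx : Ψ.symm y ∈ Ψ.source := Ψ.map_target hy
  refine ContDiffAt.sum fun i _ => ContDiffAt.sum fun j _ => ?_
  have hsymbol : ContDiffAt ℝ ∞ (Ψ.christoffelSymbol cov i j) y :=
    ((Ψ.contMDiffAt_differential_apply hx (Ψ.contMDiffAt_cov_coordField cov hx i j)).comp y
      (Ψ.contMDiffAt_symm hy)).contDiffAt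
  exact contDiffAt_const.smulRight (contDiffAt_const.smulRight hsymbol)

/-- `(∇_u σ)^λ = u(s^λ) + Γ^λ_{ij} uⁱ sʲ` for a vector field `σ` with components `s`. -/
lemma differential_cov (hx : x ∈ Ψ.source) {σ : ∀ x : M, TangentSpace (𝓡 m) x}
    (hσ : MDifferentiableAt (𝓡 m) ((𝓡 m).prod 𝓘(ℝ, 𝔼))
      (fun x => (⟨x, σ x⟩ : TangentBundle (𝓡 m) M)) x)
    {s : M → 𝔼} {s' : TangentSpace (𝓡 m) x →L[ℝ] 𝔼} (hs : HasMFDerivAt (𝓡 m) 𝓘(ℝ, 𝔼) s x s')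
    (hσs : ∀ᶠ y in 𝓝 x, Ψ.differential y (σ y) = s y) (u : TangentSpace (𝓡 m) x) :
    Ψ.differential x (cov σ x u) =
      s' u + Ψ.christoffel cov (Ψ x) (Ψ.differential x u) (s x) := by
  have hsi : ∀ i, HasMFDerivAt (𝓡 m) 𝓘(ℝ, ℝ) (fun y => s y i) x
      ((EuclideanSpace.proj i : 𝔼 →L[ℝ] ℝ).comp s') := fun i =>
    ((EuclideanSpace.proj i : 𝔼 →L[ℝ] ℝ).hasMFDerivAt).comp x hs
  have hX : ∀ i, MDifferentiableAt (𝓡 m) ((𝓡 m).prod 𝓘(ℝ, 𝔼))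
      (fun x => (⟨x, Ψ.coordField i x⟩ : TangentBundle (𝓡 m) M)) x :=
    fun i => Ψ.mdifferentiableAt_constField hx _
  have hsum : ∀ᶠ y in 𝓝 x, σ y = ∑ i, s y i • Ψ.coordField i y := by
    filter_upwards [hσs, Ψ.open_source.mem_nhds hx] with y hy hyS
    exact hy ▸ Ψ.eq_sum_coordField hyS (σ y)
  have hcov : cov σ x u = ∑ j, (s x j • cov (Ψ.coordField j) x u + s' u j • Ψ.coordField j x) := by
    rw [cov.isCovariantDerivativeOnUniv.congr_of_eventuallyEq hσ
      (MDifferentiableAt.sum_section (t := fun i => (fun y => s y i) • Ψ.coordField i)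
        (s := Finset.univ) fun i _ => (hsi i).mdifferentiableAt.smul_section (hX i)) univ_mem hsum]
    refine (DFunLike.congr_fun (covariantDerivative_sum_smul cov Finset.univ
      (fun i => (hsi i).mdifferentiableAt) hX) u).trans ?_
    simp only [mvfderiv, (hsi _).mfderiv, sum_apply]
    rfl
  have hΓ : ∀ j, Ψ.differential x (cov (Ψ.coordField j) x u) =
      ∑ i, Ψ.differential x u i • Ψ.christoffelSymbol cov i j (Ψ x) := fun j => by
    conv_lhs => rw [Ψ.eq_sum_coordField hx u]
    simp only [map_sum, map_smul, Ψ.christoffelSymbol_apply_self cov hx]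
  have hbasis : ∑ j, s' u j • Ψ.differential x (Ψ.coordField j x) = s' u := by
    simp_rw [coordField, Ψ.differential_constField hx]
    exact (EuclideanSpace.basisFun (Fin m) ℝ).sum_repr (s' u)
  rw [hcov, christoffel_apply, Finset.sum_comm, add_comm]
  simp only [map_sum, map_add, map_smul, Finset.sum_add_distrib, hbasis, hΓ, Finset.smul_sum,
    smul_smul, mul_comm]

lemma differential_covDerivAlong {γ : ℝ → M} {t : ℝ} (hx : γ t ∈ Ψ.source)
    (hγ : MDifferentiableAt 𝓘(ℝ, ℝ) (𝓡 m) γ t) (v : ∀ t : ℝ, TangentSpace (𝓡 m) (γ t))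
    {s : ℝ → 𝔼} (hs : DifferentiableAt ℝ s t)
    (hsv : ∀ᶠ τ in 𝓝 t, Ψ.differential (γ τ) (v τ) = s τ) :
    Ψ.differential (γ t) (covDerivAlong cov γ v t) = deriv s t +
      Ψ.christoffel cov (Ψ (γ t)) (Ψ.differential (γ t) (curveVelocity γ t)) (s t) := by
  let T := trivializationAt 𝔼 (TangentSpace (𝓡 m) : M → Type _) (γ t)
  let w : ℝ → 𝔼 := fun τ => (T ⟨γ τ, v τ⟩).2
  let A := Ψ.trivializedDifferential (γ t)
  have hbase : ∀ᶠ x in 𝓝 (γ t), x ∈ T.baseSet :=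
    T.open_baseSet.mem_nhds (FiberBundle.mem_baseSet_trivializationAt' (γ t))
  have hA : MDifferentiableAt (𝓡 m) 𝓘(ℝ, 𝔼 →L[ℝ] 𝔼) A (γ t) :=
    (Ψ.contMDiffAt_trivializedDifferential hx).mdifferentiableAt (by simp)
  let A' : TangentSpace (𝓡 m) (γ t) →L[ℝ] 𝔼 →L[ℝ] 𝔼 := mfderiv (𝓡 m) 𝓘(ℝ, 𝔼 →L[ℝ] 𝔼) A (γ t)
  have hAγ : HasDerivAt (fun τ => A (γ τ)) (A' (curveVelocity γ t)) t := by
    have h : HasFDerivAt (fun τ => A (γ τ)) (show ℝ →L[ℝ] 𝔼 →L[ℝ] 𝔼 from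
        A'.comp (mfderiv 𝓘(ℝ, ℝ) (𝓡 m) γ t)) t :=
      (hA.hasMFDerivAt.comp t hγ.hasMFDerivAt).hasFDerivAt
    exact h.hasDerivAt
  have hsw : ∀ᶠ τ in 𝓝 t, s τ = A (γ τ) (w τ) := by
    filter_upwards [hsv, hγ.continuousAt.eventually hbase] with τ hτ hτT
    rw [← hτ, Ψ.trivializedDifferential_apply hτT]
  have hw : DifferentiableAt ℝ w t :=
    differentiableAt_of_clm_apply hAγ.differentiableAt
      (Ψ.isInvertible_trivializedDifferential hx)
      (hs.congr_of_eventuallyEq (hsw.mono fun _ h => h.symm))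
  have hderiv : deriv s t = A' (curveVelocity γ t) (w t) + A (γ t) (deriv w t) :=
    ((hAγ.clm_apply hw.hasDerivAt).congr_of_eventuallyEq hsw).deriv
  have hAw : HasMFDerivAt (𝓡 m) 𝓘(ℝ, 𝔼) (fun x => A x (w t)) (γ t)
      ((ContinuousLinearMap.apply ℝ 𝔼 (w t)).comp A') :=
    (ContinuousLinearMap.apply ℝ 𝔼 (w t)).hasMFDerivAt.comp (γ t) hA.hasMFDerivAt
  have hextend : ∀ᶠ x in 𝓝 (γ t),
      Ψ.differential x (FiberBundle.extend 𝔼 (v t) x) = A x (w t) :=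
    hbase.mono fun x hxT => Ψ.differential_trivializationAt_symm hxT (w t)
  have hcov := Ψ.differential_cov cov hx (FiberBundle.mdifferentiableAt_extend ..) hAw hextend
    (curveVelocity γ t)
  rw [covDerivAlong, map_add, hcov, hsw.self_of_nhds, hderiv, ← add_assoc,
    Ψ.differential_trivializationAt_symm hbase.self_of_nhds]
  exact congrArg (· + _) (add_comm _ _)

end SmoothChart

end Christoffel

section SmoothODE

variable {E : Type*} [NormedAddCommGroup E] [NormedSpace ℝ E] {X : E → E}

lemma contDiffOn_of_hasDerivAt_autonomous {α : ℝ → E} {J : Set ℝ} (hJ : IsOpen J)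
    (hX : ∀ s ∈ J, ContDiffAt ℝ ∞ X (α s)) (hα : ∀ s ∈ J, HasDerivAt α (X (α s)) s) :
    ContDiffOn ℝ ∞ α J := by
  refine contDiffOn_infty.2 fun n => ?_
  induction n with
  | zero => exact contDiffOn_zero.2 fun s hs => (hα s hs).continuousAt.continuousWithinAt
  | succ n ih =>
    push_cast
    rw [contDiffOn_succ_iff_deriv_of_isOpen hJ]
    refine ⟨fun s hs => (hα s hs).differentiableAt.differentiableWithinAt, by simp, ?_⟩
    refine ContDiffOn.congr (fun s hs => ?_) fun s hs => (hα s hs).deriv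
    exact ((hX s hs).of_le (by exact_mod_cast le_top)).comp_contDiffWithinAt s (ih s hs)

lemma eventuallyEq_of_hasDerivAt_autonomous {α β : ℝ → E} {s : ℝ} (hX : ContDiffAt ℝ ∞ X (α s))
    (hα : ∀ᶠ τ in 𝓝 s, HasDerivAt α (X (α τ)) τ) (hβ : ∀ᶠ τ in 𝓝 s, HasDerivAt β (X (β τ)) τ)
    (h : α s = β s) : α =ᶠ[𝓝 s] β := by
  obtain ⟨K, S, hS, hlip⟩ := (hX.of_le (by simp : (1 : WithTop ℕ∞) ≤ ∞)).exists_lipschitzOnWith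
  exact ODE_solution_unique_of_eventually (v := fun _ => X) (s := fun _ => S)
    (.of_forall fun _ => hlip) (hα.and (hα.self_of_nhds.continuousAt.eventually hS))
    (hβ.and (hβ.self_of_nhds.continuousAt.eventually (h ▸ hS))) h

end SmoothODE

section Geodesic

variable {m : ℕ} {M : Type*} [TopologicalSpace M] [ChartedSpace (EuclideanSpace ℝ (Fin m)) M]

local notation "𝔼" => EuclideanSpace ℝ (Fin m)

/-- The geodesic spray `(y, v) ↦ (v, -Γ_y(v, v))` of a family of bilinear maps `Γ`: its integral
curves are the pairs `(c, c')` with `c'' + Γ_c(c', c') = 0`. -/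
noncomputable def spray {E : Type*} [NormedAddCommGroup E] [NormedSpace ℝ E]
    (Γ : E → E →L[ℝ] E →L[ℝ] E) (p : E × E) : E × E :=
  (p.2, -Γ p.1 p.2 p.2)

lemma contDiffAt_spray {E : Type*} [NormedAddCommGroup E] [NormedSpace ℝ E]
    {Γ : E → E →L[ℝ] E →L[ℝ] E} {p : E × E} (hΓ : ContDiffAt ℝ ∞ Γ p.1) :
    ContDiffAt ℝ ∞ (spray Γ) p :=
  contDiffAt_snd.prodMk
    (((hΓ.comp p contDiffAt_fst).clm_apply contDiffAt_snd).clm_apply contDiffAt_snd).neg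

lemma eventually_contMDiffAt {c : ℝ → M} {J : Set ℝ} (hJ : IsOpen J)
    (hc : ContMDiffOn 𝓘(ℝ, ℝ) (𝓡 m) ∞ c J) {s : ℝ} (hs : s ∈ J) :
    ∀ᶠ τ in 𝓝 s, ContMDiffAt 𝓘(ℝ, ℝ) (𝓡 m) ∞ c τ := by
  filter_upwards [hJ.mem_nhds hs] with τ hτ using (hc τ hτ).contMDiffAt (hJ.mem_nhds hτ)

namespace SmoothChart

variable (Ψ : SmoothChart m M) {c : ℝ → M} {s : ℝ}

lemma smoothNear_comp (hc : ∀ᶠ τ in 𝓝 s, ContMDiffAt 𝓘(ℝ, ℝ) (𝓡 m) ∞ c τ)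
    (hs : c s ∈ Ψ.source) : SmoothNear (fun s => Ψ (c s)) s := by
  filter_upwards [hc, hc.self_of_nhds.continuousAt.eventually (Ψ.open_source.mem_nhds hs)]
    with τ hcτ hτ using ((Ψ.contMDiffAt hτ).comp τ hcτ).contDiffAt

lemma differential_curveVelocity (hc : MDifferentiableAt 𝓘(ℝ, ℝ) (𝓡 m) c s)
    (hs : c s ∈ Ψ.source) :
    Ψ.differential (c s) (curveVelocity c s) = deriv (fun s => Ψ (c s)) s := by
  have hcomp : HasFDerivAt (fun s => Ψ (c s)) (show ℝ →L[ℝ] 𝔼 from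
      (mfderiv (𝓡 m) 𝓘(ℝ, 𝔼) Ψ (c s)).comp (mfderiv 𝓘(ℝ, ℝ) (𝓡 m) c s)) s :=
    (((Ψ.contMDiffAt hs).mdifferentiableAt (by simp)).hasMFDerivAt.comp s
      hc.hasMFDerivAt).hasFDerivAt
  exact hcomp.hasDerivAt.deriv.symm

lemma eventually_differential_curveVelocity
    (hc : ∀ᶠ τ in 𝓝 s, ContMDiffAt 𝓘(ℝ, ℝ) (𝓡 m) ∞ c τ) (hs : c s ∈ Ψ.source) :
    ∀ᶠ τ in 𝓝 s, Ψ.differential (c τ) (curveVelocity c τ) = deriv (fun s => Ψ (c s)) τ := by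
  filter_upwards [hc, hc.self_of_nhds.continuousAt.eventually (Ψ.open_source.mem_nhds hs)]
    with τ hcτ hτ using Ψ.differential_curveVelocity (hcτ.mdifferentiableAt (by simp)) hτ

variable [IsManifold (𝓡 m) ∞ M]
  (cov : CovariantDerivative (𝓡 m) (EuclideanSpace ℝ (Fin m)) (TangentSpace (𝓡 m) : M → Type _))

lemma differential_covDerivAlong_curveVelocity
    (hc : ∀ᶠ τ in 𝓝 s, ContMDiffAt 𝓘(ℝ, ℝ) (𝓡 m) ∞ c τ) (hs : c s ∈ Ψ.source) :
    Ψ.differential (c s) (covDerivAlong cov c (curveVelocity c) s) =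
      deriv (deriv fun s => Ψ (c s)) s + Ψ.christoffel cov (Ψ (c s))
        (deriv (fun s => Ψ (c s)) s) (deriv (fun s => Ψ (c s)) s) := by
  have hvel := Ψ.eventually_differential_curveVelocity hc hs
  rw [Ψ.differential_covDerivAlong cov hs (hc.self_of_nhds.mdifferentiableAt (by simp)) _
    (Ψ.smoothNear_comp hc hs).deriv.differentiableAt hvel, hvel.self_of_nhds]

lemma covDerivAlong_curveVelocity_eq_zero_iff
    (hc : ∀ᶠ τ in 𝓝 s, ContMDiffAt 𝓘(ℝ, ℝ) (𝓡 m) ∞ c τ) (hs : c s ∈ Ψ.source) :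
    covDerivAlong cov c (curveVelocity c) s = 0 ↔
      deriv (deriv fun s => Ψ (c s)) s = -Ψ.christoffel cov (Ψ (c s))
        (deriv (fun s => Ψ (c s)) s) (deriv (fun s => Ψ (c s)) s) := by
  rw [← map_eq_zero_iff _ (Ψ.isInvertible_differential hs).injective,
    Ψ.differential_covDerivAlong_curveVelocity cov hc hs, add_eq_zero_iff_eq_neg]

/-- The lift of a curve to the tangent bundle, in coordinates: position and velocity. -/
noncomputable def phaseCurve (c : ℝ → M) (s : ℝ) : 𝔼 × 𝔼 :=
  (Ψ (c s), deriv (fun s => Ψ (c s)) s)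

variable {cov} {J : Set ℝ}

lemma hasDerivAt_phaseCurve (hJ : IsOpen J) (hc : IsGeodesicCurveOn cov c J) (hs : s ∈ J)
    (hsrc : c s ∈ Ψ.source) :
    HasDerivAt (Ψ.phaseCurve c) (spray (Ψ.christoffel cov) (Ψ.phaseCurve c s)) s := by
  have hsmooth := eventually_contMDiffAt hJ hc.smooth hs
  have hcoord := Ψ.smoothNear_comp hsmooth hsrc
  have hacc := hcoord.deriv.differentiableAt.hasDerivAt
  rw [(Ψ.covDerivAlong_curveVelocity_eq_zero_iff cov hsmooth hsrc).1 (hc.geodesic s hs)] at hacc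
  exact hcoord.differentiableAt.hasDerivAt.prodMk hacc

lemma phaseCurve_zero_eq_of_isGeodesicFrom {p : TangentBundle (𝓡 m) M}
    (h : IsGeodesicFrom cov p c J) (hp : p.proj ∈ Ψ.source) :
    Ψ.phaseCurve c 0 = (Ψ p.proj, Ψ.differential p.proj p.2) := by
  obtain rfl := h.initial
  rw [phaseCurve, Ψ.differential_curveVelocity ((eventually_contMDiffAt h.isOpen
    h.isGeodesic.smooth h.zero_mem).self_of_nhds.mdifferentiableAt (by simp)) hp]

lemma isGeodesicCurveOn_symm_comp [T2Space M]
    [CovariantDerivative.ContMDiffCovariantDerivative cov ∞] (hJ : IsOpen J) {α : ℝ → 𝔼 × 𝔼}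
    (hαJ : ∀ s ∈ J, (α s).1 ∈ Ψ.target)
    (hα : ∀ s ∈ J, HasDerivAt α (spray (Ψ.christoffel cov) (α s)) s) :
    IsGeodesicCurveOn cov (fun s => Ψ.symm (α s).1) J := by
  have hαsmooth : ContDiffOn ℝ ∞ α J := contDiffOn_of_hasDerivAt_autonomous hJ
    (fun s hs => contDiffAt_spray (Ψ.contDiffAt_christoffel cov (hαJ s hs))) hα
  have hsmooth : ContMDiffOn 𝓘(ℝ, ℝ) (𝓡 m) ∞ (fun s => Ψ.symm (α s).1) J :=
    Ψ.symm.contMDiffOn.comp (contDiff_fst.comp_contDiffOn hαsmooth).contMDiffOn hαJ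
  refine ⟨hsmooth, fun s hs => ?_⟩
  have hpos : ∀ τ ∈ J, Ψ (Ψ.symm (α τ).1) = (α τ).1 := fun τ hτ => Ψ.right_inv (hαJ τ hτ)
  have hvel : ∀ τ ∈ J, deriv (fun s => Ψ (Ψ.symm (α s).1)) τ = (α τ).2 := fun τ hτ =>
    ((hasFDerivAt_fst.comp_hasDerivAt τ (hα τ hτ)).congr_of_eventuallyEq
      (eventually_of_mem (hJ.mem_nhds hτ) hpos)).deriv
  have hacc : deriv (deriv fun s => Ψ (Ψ.symm (α s).1)) s = _ :=
    ((hasFDerivAt_snd.comp_hasDerivAt s (hα s hs)).congr_of_eventuallyEq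
      (eventually_of_mem (hJ.mem_nhds hs) hvel)).deriv
  rw [Ψ.covDerivAlong_curveVelocity_eq_zero_iff cov (eventually_contMDiffAt hJ hsmooth hs)
    (Ψ.map_target (hαJ s hs)), hacc, hvel s hs, hpos s hs]
  rfl

lemma exists_isGeodesicCurveOn [T2Space M]
    [CovariantDerivative.ContMDiffCovariantDerivative cov ∞] {y : 𝔼} (hy : y ∈ Ψ.target)
    (v : 𝔼) : ∃ (α : ℝ → 𝔼 × 𝔼) (ε : ℝ), 0 < ε ∧ α 0 = (y, v) ∧
      IsGeodesicCurveOn cov (fun s => Ψ.symm (α s).1) (Metric.ball 0 ε) ∧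
      ∀ s ∈ Metric.ball 0 ε, (α s).1 ∈ Ψ.target ∧
        HasDerivAt α (spray (Ψ.christoffel cov) (α s)) s := by
  have hspray := contDiffAt_spray (p := (y, v)) (Ψ.contDiffAt_christoffel cov hy)
  obtain ⟨r, hr, δ, hδ, hflow⟩ := (hspray.of_le (by simp :
    (1 : WithTop ℕ∞) ≤ ∞)).exists_forall_mem_closedBall_exists_eq_forall_mem_Ioo_hasDerivAt 0
  obtain ⟨α, hα₀, hα⟩ := hflow _ (Metric.mem_closedBall_self hr.le)
  have hmem : (0 : ℝ) ∈ Ioo (0 - δ) (0 + δ) := by constructor <;> linarith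
  have hfst : ContinuousAt (fun s => (α s).1) 0 := (hα 0 hmem).continuousAt.fst
  obtain ⟨ε, hε, hball⟩ := Metric.eventually_nhds_iff_ball.1
    ((hfst.eventually (Ψ.open_target.mem_nhds (by simpa only [hα₀] using hy))).and
      (isOpen_Ioo.mem_nhds hmem))
  exact ⟨α, ε, hε, hα₀, Ψ.isGeodesicCurveOn_symm_comp Metric.isOpen_ball
    (fun s hs => (hball s hs).1) fun s hs => hα s (hball s hs).2,
    fun s hs => ⟨(hball s hs).1, hα s (hball s hs).2⟩⟩

variable [T2Space M] [CovariantDerivative.ContMDiffCovariantDerivative cov ∞]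
  {c₁ c₂ : ℝ → M} {J₁ J₂ : Set ℝ}

lemma eventuallyEq_of_isGeodesicCurveOn (hJ₁ : IsOpen J₁) (hJ₂ : IsOpen J₂)
    (hc₁ : IsGeodesicCurveOn cov c₁ J₁) (hc₂ : IsGeodesicCurveOn cov c₂ J₂) (hs₁ : s ∈ J₁)
    (hs₂ : s ∈ J₂) (hsrc₁ : c₁ s ∈ Ψ.source) (hsrc₂ : c₂ s ∈ Ψ.source)
    (hphase : Ψ.phaseCurve c₁ s = Ψ.phaseCurve c₂ s) : c₁ =ᶠ[𝓝 s] c₂ := by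
  have hsource : ∀ {c : ℝ → M} {J : Set ℝ}, IsOpen J → IsGeodesicCurveOn cov c J → s ∈ J →
      c s ∈ Ψ.source → ∀ᶠ τ in 𝓝 s, τ ∈ J ∧ c τ ∈ Ψ.source := fun hJ hc hs hsrc =>
    (hJ.eventually_mem hs).and ((eventually_contMDiffAt hJ hc.smooth hs).self_of_nhds.continuousAt
      |>.eventually (Ψ.open_source.mem_nhds hsrc))
  have hev₁ := hsource hJ₁ hc₁ hs₁ hsrc₁
  have hev₂ := hsource hJ₂ hc₂ hs₂ hsrc₂
  have hspray : ContDiffAt ℝ ∞ (spray (Ψ.christoffel cov)) (Ψ.phaseCurve c₁ s) :=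
    contDiffAt_spray (Ψ.contDiffAt_christoffel cov (Ψ.map_source hsrc₁))
  filter_upwards [hev₁, hev₂, eventuallyEq_of_hasDerivAt_autonomous hspray
    (hev₁.mono fun τ hτ => Ψ.hasDerivAt_phaseCurve hJ₁ hc₁ hτ.1 hτ.2)
    (hev₂.mono fun τ hτ => Ψ.hasDerivAt_phaseCurve hJ₂ hc₂ hτ.1 hτ.2) hphase]
    with τ hτ₁ hτ₂ heq using Ψ.injOn hτ₁.2 hτ₂.2 (congrArg Prod.fst heq)

lemma eqOn_of_isGeodesicFrom {p : TangentBundle (𝓡 m) M} (h₁ : IsGeodesicFrom cov p c₁ J₁)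
    (h₂ : IsGeodesicFrom cov p c₂ J₂) (hsrc : MapsTo c₂ J₂ Ψ.source) :
    EqOn c₁ c₂ (J₁ ∩ J₂) := by
  have hlocal : ∀ s ∈ J₁ ∩ J₂, c₁ s = c₂ s → (c₁ s ∈ Ψ.source →
      Ψ.phaseCurve c₁ s = Ψ.phaseCurve c₂ s) → c₁ =ᶠ[𝓝 s] c₂ := fun s hs heq hphase =>
    have hsrc₁ : c₁ s ∈ Ψ.source := heq ▸ hsrc hs.2
    Ψ.eventuallyEq_of_isGeodesicCurveOn h₁.isOpen h₂.isOpen h₁.isGeodesic h₂.isGeodesic hs.1 hs.2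
      hsrc₁ (hsrc hs.2) (hphase hsrc₁)
  have hcont : ∀ {c : ℝ → M} {J : Set ℝ}, IsGeodesicFrom cov p c J → ∀ s ∈ J, ContinuousAt c s :=
    fun h s hs => (eventually_contMDiffAt h.isOpen h.isGeodesic.smooth hs).self_of_nhds.continuousAt
  have hsub : J₁ ∩ J₂ ⊆ {s | c₁ =ᶠ[𝓝 s] c₂} := by
    refine (h₁.ordConnected.inter h₂.ordConnected).isPreconnected.subset_of_closure_inter_subset
      isOpen_setOfPred_eventually_nhds ⟨0, ⟨h₁.zero_mem, h₂.zero_mem⟩, ?_⟩ ?_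
    · have hp₂ : c₂ 0 = p.proj := congrArg Bundle.TotalSpace.proj h₂.initial
      have hp : p.proj ∈ Ψ.source := hp₂ ▸ hsrc h₂.zero_mem
      refine hlocal 0 ⟨h₁.zero_mem, h₂.zero_mem⟩
        ((congrArg Bundle.TotalSpace.proj h₁.initial).trans hp₂.symm) fun _ => ?_
      rw [Ψ.phaseCurve_zero_eq_of_isGeodesicFrom h₁ hp,
        Ψ.phaseCurve_zero_eq_of_isGeodesicFrom h₂ hp]
    · rintro s ⟨hcl, hs⟩
      have hfr : ∃ᶠ τ in 𝓝 s, c₁ =ᶠ[𝓝 τ] c₂ := mem_closure_iff_frequently.1 hcl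
      refine hlocal s hs (tendsto_nhds_unique_of_frequently_eq (hcont h₁ s hs.1) (hcont h₂ s hs.2)
        (hfr.mono fun τ h => h.eq_of_nhds)) fun hsrc₁ => ?_
      exact tendsto_nhds_unique_of_frequently_eq
        (Ψ.hasDerivAt_phaseCurve h₁.isOpen h₁.isGeodesic hs.1 hsrc₁).continuousAt
        (Ψ.hasDerivAt_phaseCurve h₂.isOpen h₂.isGeodesic hs.2 (hsrc hs.2)).continuousAt
        (hfr.mono fun τ h => Prod.ext (congrArg Ψ h.eq_of_nhds) (h.fun_comp Ψ).deriv_eq)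
  exact fun s hs => (hsub hs).eq_of_nhds

lemma geodesicMap_eq {p : TangentBundle (𝓡 m) M} (h : IsGeodesicFrom cov p c J)
    (hsrc : MapsTo c J Ψ.source) (hs : s ∈ J) : geodesicMap cov p s = c s := by
  have hex : ∃ c : ℝ → M, ∃ J : Set ℝ, IsGeodesicFrom cov p c J ∧ s ∈ J := ⟨c, J, h, hs⟩
  rw [geodesicMap, dif_pos hex]
  obtain ⟨J', hJ', hsJ'⟩ := hex.choose_spec
  exact Ψ.eqOn_of_isGeodesicFrom hJ' h hsrc ⟨hsJ', hs⟩

end SmoothChart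

end Geodesic

section Flatness

lemma hasDerivAt_mem_of_eventually_sub_mem {E : Type*} [NormedAddCommGroup E] [NormedSpace ℝ E]
    {S : Submodule ℝ E} (hS : IsClosed (S : Set E)) {y : ℝ → E} {y' : E} {s : ℝ}
    (hy : HasDerivAt y y' s) (hmem : ∀ᶠ τ in 𝓝 s, y τ - y s ∈ S) : y' ∈ S :=
  hS.mem_of_tendsto (hasDerivAt_iff_tendsto_slope.1 hy)
    ((hmem.filter_mono nhdsWithin_le_nhds).mono fun _ hτ => S.smul_mem _ hτ)

lemma exists_deriv_eq_smul_of_forall_mem_line {E : Type*} [NormedAddCommGroup E] [NormedSpace ℝ E]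
    {y y₁ : ℝ → E} {w a b : E} {J : Set ℝ} (hJ : IsOpen J) {s : ℝ} (hs : s ∈ J)
    (hy : ∀ s ∈ J, HasDerivAt y (y₁ s) s) (hy₁ : HasDerivAt y₁ w s)
    (hline : ∀ s ∈ J, ∃ r : ℝ, y s = a + r • b) (hne : y₁ s ≠ 0) : ∃ l : ℝ, w = l • y₁ s := by
  have hclosed : IsClosed (ℝ ∙ b : Set E) := Submodule.closed_of_finiteDimensional _
  have hvel : ∀ s ∈ J, y₁ s ∈ ℝ ∙ b := fun s hs =>
    hasDerivAt_mem_of_eventually_sub_mem hclosed (hy s hs) (by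
      filter_upwards [hJ.mem_nhds hs] with τ hτ
      obtain ⟨r, hr⟩ := hline τ hτ
      obtain ⟨r₀, hr₀⟩ := hline s hs
      exact Submodule.mem_span_singleton.2 ⟨r - r₀, by rw [hr, hr₀]; module⟩)
  have hacc : w ∈ ℝ ∙ b := hasDerivAt_mem_of_eventually_sub_mem hclosed hy₁ (by
    filter_upwards [hJ.mem_nhds hs] with τ hτ using sub_mem (hvel τ hτ) (hvel s hs))
  obtain ⟨p, hp⟩ := Submodule.mem_span_singleton.1 (hvel s hs)
  obtain ⟨l, rfl⟩ := Submodule.mem_span_singleton.1 hacc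
  have hp₀ : p ≠ 0 := by rintro rfl; exact hne (by rw [← hp, zero_smul])
  exact ⟨l / p, by rw [← hp, smul_smul, div_mul_cancel₀ l hp₀]⟩

lemma exists_apply_apply_eq_add_of_forall_self {E : Type*} [NormedAddCommGroup E]
    [NormedSpace ℝ E] {B : E →L[ℝ] E →L[ℝ] E} (hB : ∀ u w, B u w = B w u)
    (hself : ∀ v, ∃ l : ℝ, B v v = l • v) (u w : E) : ∃ a b : ℝ, B u w = a • u + b • w := by
  obtain ⟨l₁, h₁⟩ := hself u
  obtain ⟨l₂, h₂⟩ := hself w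
  obtain ⟨l₃, h₃⟩ := hself (u + w)
  have hpolar : (2 : ℝ) • B u w = B (u + w) (u + w) - B u u - B w w := by
    simp only [map_add, add_apply, hB w u]
    module
  rw [h₁, h₂, h₃] at hpolar
  refine ⟨(l₃ - l₁) / 2, (l₃ - l₂) / 2, smul_right_injective E (two_ne_zero' ℝ) ?_⟩
  beta_reduce
  rw [hpolar]
  module

variable {m : ℕ} {M : Type*} [TopologicalSpace M] [ChartedSpace (EuclideanSpace ℝ (Fin m)) M]

local notation "𝔼" => EuclideanSpace ℝ (Fin m)

namespace SmoothChart

lemma exists_restrict (Ψ : SmoothChart m M) {S : Set M} (hS : IsOpen S) :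
    ∃ Ψ' : SmoothChart m M, Ψ'.source = Ψ.source ∩ S ∧ ∀ x, Ψ' x = Ψ x :=
  ⟨{ Ψ.toOpenPartialHomeomorph.restrOpen S hS with
      contMDiffOn_toFun := Ψ.contMDiffOn_toFun.mono inter_subset_left
      contMDiffOn_invFun := Ψ.contMDiffOn_invFun.mono inter_subset_left }, rfl, fun _ => rfl⟩

variable [IsManifold (𝓡 m) ∞ M]

/-- The smooth chart `Ψ` maps the `∇`-geodesics in its domain to straight lines, up to
parametrization. -/
def MapsGeodesicsToLines (Ψ : SmoothChart m M)
    (cov : CovariantDerivative (𝓡 m) (EuclideanSpace ℝ (Fin m))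
      (TangentSpace (𝓡 m) : M → Type _)) : Prop :=
  ∀ (c : ℝ → M) (J : Set ℝ), IsOpen J → J.OrdConnected → IsGeodesicCurveOn cov c J →
    MapsTo c J Ψ.source → ∃ a b : 𝔼, ∀ s ∈ J, ∃ r : ℝ, Ψ (c s) = a + r • b

variable {cov : CovariantDerivative (𝓡 m) (EuclideanSpace ℝ (Fin m))
  (TangentSpace (𝓡 m) : M → Type _)}

lemma exists_mapsGeodesicsToLines {q : M} (hflat : IsProjectivelyFlatAround cov q) :
    ∃ Ψ : SmoothChart m M, q ∈ Ψ.source ∧ Ψ.MapsGeodesicsToLines cov := by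
  obtain ⟨Φ, ⟨Ψ₀, hq, heq⟩, U, hU, hlines⟩ := hflat
  obtain ⟨Ψ, hsrc, hΨ⟩ := SmoothChart.exists_restrict Ψ₀ (isOpen_interior (s := U))
  refine ⟨Ψ, hsrc ▸ ⟨hq, mem_interior_iff_mem_nhds.2 hU⟩, fun c J hJ hJ' hc hcJ => ?_⟩
  rw [hsrc] at hcJ
  obtain ⟨a, b, hab⟩ := hlines c J hJ hJ' hc fun s hs => interior_subset (hcJ hs).2
  refine ⟨a, b, fun s hs => ?_⟩
  rw [hΨ, ← heq (hcJ hs).1]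
  exact hab s hs

namespace MapsGeodesicsToLines

variable {Ψ : SmoothChart m M} [T2Space M]
  [CovariantDerivative.ContMDiffCovariantDerivative cov ∞]

lemma exists_christoffel_self_eq_smul (hΨ : Ψ.MapsGeodesicsToLines cov) {y : 𝔼}
    (hy : y ∈ Ψ.target) (v : 𝔼) : ∃ l : ℝ, Ψ.christoffel cov y v v = l • v := by
  obtain rfl | hv := eq_or_ne v 0
  · exact ⟨0, by rw [map_zero, smul_zero]⟩
  obtain ⟨α, ε, hε, hα₀, hgeo, hα⟩ := Ψ.exists_isGeodesicCurveOn (cov := cov) hy v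
  have hmem : (0 : ℝ) ∈ Metric.ball 0 ε := Metric.mem_ball_self hε
  obtain ⟨a, b, hab⟩ := hΨ _ _ Metric.isOpen_ball (convex_ball _ _).ordConnected hgeo
    fun s hs => Ψ.map_target (hα s hs).1
  obtain ⟨l, hl⟩ := exists_deriv_eq_smul_of_forall_mem_line (a := a) (b := b) Metric.isOpen_ball
    hmem (fun s hs => hasFDerivAt_fst.comp_hasDerivAt s (hα s hs).2)
    (hasFDerivAt_snd.comp_hasDerivAt 0 (hα 0 hmem).2)
    (fun s hs => (hab s hs).imp fun r hr => (Ψ.right_inv (hα s hs).1).symm.trans hr)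
    (show (α 0).2 ≠ 0 by rwa [hα₀])
  have hspray : -Ψ.christoffel cov y v v = l • v := by simpa [spray, hα₀] using hl
  exact ⟨-l, by rw [neg_smul, ← hspray, neg_neg]⟩

lemma exists_christoffel_eq_add (hΨ : Ψ.MapsGeodesicsToLines cov) (htorsion : cov.torsion = 0)
    {y : 𝔼} (hy : y ∈ Ψ.target) (u w : 𝔼) :
    ∃ a b : ℝ, Ψ.christoffel cov y u w = a • u + b • w :=
  exists_apply_apply_eq_add_of_forall_self (Ψ.christoffel_comm cov htorsion hy)
    (hΨ.exists_christoffel_self_eq_smul hy) u w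

end MapsGeodesicsToLines

end SmoothChart

end Flatness

section Reparametrization

variable {t₀ : ℝ}

lemma hasFDerivAt_of_eventually_eq_zero_on_axis {f : ℝ × ℝ → ℝ} {c : ℝ}
    (hf : DifferentiableAt ℝ f (t₀, 0)) (hf₀ : ∀ᶠ t in 𝓝 t₀, f (t, 0) = 0)
    (hc : HasDerivAt (fun s => f (t₀, s)) c 0) :
    HasFDerivAt f (c • ContinuousLinearMap.snd ℝ ℝ ℝ) (t₀, 0) := by
  have hleft : fderiv ℝ f (t₀, 0) (1, 0) = 0 :=
    (hf.hasFDerivAt.comp_hasDerivAt t₀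
      ((hasDerivAt_id t₀).prodMk (hasDerivAt_const t₀ (0 : ℝ)))).unique
      ((hasDerivAt_const t₀ (0 : ℝ)).congr_of_eventuallyEq hf₀)
  have hright : fderiv ℝ f (t₀, 0) (0, 1) = c :=
    (hf.hasFDerivAt.comp_hasDerivAt (0 : ℝ)
      ((hasDerivAt_const (0 : ℝ) t₀).prodMk (hasDerivAt_id 0))).unique hc
  convert hf.hasFDerivAt using 1
  ext
  · simp [hleft]
  · simp [hright]

lemma SmoothNear.primitive {k : ℝ × ℝ → ℝ} (hk : SmoothNear k (t₀, 0)) :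
    SmoothNear (fun z : ℝ × ℝ => ∫ τ in (0 : ℝ)..z.2, k (z.1, τ)) (t₀, 0) := by
  have hrescale : ∀ z : ℝ × ℝ, ∫ τ in (0 : ℝ)..z.2, k (z.1, τ) =
      z.2 * ∫ θ in (0 : ℝ)..1, k (z.1, z.2 * θ) := fun z => by
    rw [intervalIntegral.mul_integral_comp_mul_left (f := fun τ => k (z.1, τ)), mul_zero, mul_one]
  refine SmoothNear.congr ((of_contDiff contDiff_snd).mul
    (.integral (k := fun p : (ℝ × ℝ) × ℝ => k (p.1.1, p.1.2 * p.2)) fun θ _ => ?_))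
    (.of_forall hrescale)
  refine .comp (f := fun p : (ℝ × ℝ) × ℝ => (p.1.1, p.1.2 * p.2)) _ ?_ (of_contDiff (by fun_prop))
  simpa only [zero_mul] using hk

lemma SmoothNear.hasDerivAt_primitive {k : ℝ × ℝ → ℝ} (hk : SmoothNear k (t₀, 0)) :
    ∀ᶠ z : ℝ × ℝ in 𝓝 (t₀, 0),
      HasDerivAt (fun ρ => ∫ τ in (0 : ℝ)..ρ, k (z.1, τ)) (k z) z.2 := by
  obtain ⟨ε, hε, hball⟩ := Metric.eventually_nhds_iff_ball.1 hk
  filter_upwards [Metric.ball_mem_nhds _ hε] with z hz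
  rw [← ball_prod_same] at hball hz
  have hcont : ContinuousOn (fun τ => k (z.1, τ)) (Metric.ball 0 ε) := fun τ hτ =>
    ((hball (z.1, τ) ⟨hz.1, hτ⟩).continuousAt.comp
      (f := fun τ : ℝ => (z.1, τ)) (by fun_prop)).continuousWithinAt
  have hsub : uIcc 0 z.2 ⊆ Metric.ball 0 ε :=
    (convex_ball (0 : ℝ) ε).ordConnected.uIcc_subset (Metric.mem_ball_self hε) hz.2
  exact intervalIntegral.integral_hasDerivAt_right (hcont.mono hsub).intervalIntegrable
    (hcont.stronglyMeasurableAtFilter Metric.isOpen_ball _ hz.2)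
    (hcont.continuousAt (Metric.isOpen_ball.mem_nhds hz.2))

lemma SmoothNear.exists_fiberwise_inverse {P P' : ℝ × ℝ → ℝ} (hP : SmoothNear P (t₀, 0))
    (hP₀ : ∀ᶠ t in 𝓝 t₀, P (t, 0) = 0)
    (hP' : ∀ᶠ z : ℝ × ℝ in 𝓝 (t₀, 0), HasDerivAt (fun ρ => P (z.1, ρ)) (P' z) z.2)
    (hne : ∀ᶠ z in 𝓝 (t₀, 0), P' z ≠ 0) :
    ∃ r : ℝ × ℝ → ℝ, SmoothNear r (t₀, 0) ∧ (∀ᶠ t in 𝓝 t₀, r (t, 0) = 0) ∧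
      ∀ᶠ z : ℝ × ℝ in 𝓝 (t₀, 0), HasDerivAt (fun s => r (z.1, s)) (P' (z.1, r z))⁻¹ z.2 := by
  have hfderiv := (hasFDerivAt_fst (𝕜 := ℝ) (p := ((t₀, 0) : ℝ × ℝ))).prodMk
    (hasFDerivAt_of_eventually_eq_zero_on_axis hP.differentiableAt hP₀ hP'.self_of_nhds)
  obtain ⟨h, hsrc, hcoe, -, hsymm⟩ := ((of_contDiff contDiff_fst).prodMk hP)
    |>.exists_openPartialHomeomorph (e := (ContinuousLinearEquiv.refl ℝ ℝ).prodCongr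
      (ContinuousLinearEquiv.unitsEquivAut ℝ (Units.mk0 _ hne.self_of_nhds)))
    (hfderiv.congr_fderiv (by ext <;> simp))
  have hsymm_axis : ∀ᶠ t in 𝓝 t₀, h.symm (t, 0) = (t, 0) := by
    filter_upwards [hP₀, (by fun_prop : Continuous fun t : ℝ => ((t, 0) : ℝ × ℝ)).continuousAt
      |>.eventually (h.open_source.mem_nhds hsrc)] with t ht hts
    simpa only [hcoe, ht] using h.left_inv hts
  have hcoe₀ : h (t₀, 0) = (t₀, 0) := by rw [hcoe, hP₀.self_of_nhds]
  have htgt : ∀ᶠ z in 𝓝 ((t₀, 0) : ℝ × ℝ), z ∈ h.target :=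
    h.open_target.mem_nhds (hcoe₀ ▸ h.map_source hsrc)
  have hinv : ∀ z ∈ h.target, (h.symm z).1 = z.1 ∧ P (z.1, (h.symm z).2) = z.2 := fun z hz => by
    obtain ⟨hfst, hsnd⟩ := Prod.ext_iff.1 ((hcoe _).symm.trans (h.right_inv hz))
    exact ⟨hfst, by rw [← hfst]; exact hsnd⟩
  have htendsto : Tendsto h.symm (𝓝 (t₀, 0)) (𝓝 (t₀, 0)) := by
    simpa only [hsymm_axis.self_of_nhds] using
      (h.continuousAt_symm htgt.self_of_nhds).tendsto
  refine ⟨fun z => (h.symm z).2,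
    .comp (h := Prod.snd) _ (of_contDiff contDiff_snd)
      (of_contDiffOn hsymm h.open_target htgt.self_of_nhds),
    hsymm_axis.mono fun t ht => congrArg Prod.snd ht, ?_⟩
  filter_upwards [htgt, htendsto.eventually hP', htendsto.eventually hne] with z hz hPz hne_z
  have hline : ContinuousAt (fun s : ℝ => (z.1, s)) z.2 := by fun_prop
  have hz' : h.symm z = (z.1, (h.symm z).2) := Prod.ext (hinv z hz).1 rfl
  rw [hz'] at hPz hne_z
  exact HasDerivAt.of_local_left_inverse (f := fun ρ => P (z.1, ρ))
    (ContinuousAt.comp (f := fun s : ℝ => (z.1, s)) (h.continuousAt_symm hz) hline).snd hPz hne_z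
    ((hline.eventually (h.open_target.mem_nhds hz)).mono fun s hs => (hinv _ hs).2)

/- With `L` a primitive of `κ`, the equation says that `r' exp (L (t, r))` is constant in `s`; so
`r` is inverse to a primitive of `exp L`. -/
lemma SmoothNear.exists_affine_reparametrization {κ : ℝ × ℝ → ℝ} (hκ : SmoothNear κ (t₀, 0)) :
    ∃ r r₁ : ℝ × ℝ → ℝ, SmoothNear r (t₀, 0) ∧ (∀ᶠ t in 𝓝 t₀, r (t, 0) = 0 ∧ r₁ (t, 0) = 1) ∧
      ∀ᶠ z : ℝ × ℝ in 𝓝 (t₀, 0), HasDerivAt (fun s => r (z.1, s)) (r₁ z) z.2 ∧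
        HasDerivAt (fun s => r₁ (z.1, s)) (-(κ (z.1, r z) * r₁ z ^ 2)) z.2 := by
  let L : ℝ × ℝ → ℝ := fun z => ∫ τ in (0 : ℝ)..z.2, κ (z.1, τ)
  have hL₀ : ∀ t, L (t, 0) = 0 := fun t => intervalIntegral.integral_same
  have hexp : SmoothNear (fun z => Real.exp (L z)) (t₀, 0) :=
    .comp _ (of_contDiff Real.contDiff_exp) hκ.primitive
  obtain ⟨r, hr, hr₀, hr'⟩ := hexp.primitive.exists_fiberwise_inverse
    (.of_forall fun t => intervalIntegral.integral_same) hexp.hasDerivAt_primitive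
    (.of_forall fun z => (Real.exp_pos _).ne')
  simp only [← Real.exp_neg] at hr'
  have htendsto : Tendsto (fun z : ℝ × ℝ => (z.1, r z)) (𝓝 (t₀, 0)) (𝓝 (t₀, 0)) := by
    simpa only [ContinuousAt, hr₀.self_of_nhds] using continuousAt_fst.prodMk hr.continuousAt
  refine ⟨r, fun z => Real.exp (-L (z.1, r z)), hr,
    hr₀.mono fun t ht => ⟨ht, by simp only [ht, hL₀, neg_zero, Real.exp_zero]⟩, ?_⟩
  filter_upwards [hr', htendsto.eventually hκ.hasDerivAt_primitive] with z hrz hLz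
  have hLr : HasDerivAt (fun s => L (z.1, r (z.1, s)))
      (κ (z.1, r z) * Real.exp (-L (z.1, r z))) z.2 :=
    HasDerivAt.comp z.2 (h₂ := fun ρ => L (z.1, ρ)) hLz hrz
  exact ⟨hrz, hLr.fun_neg.exp.congr_deriv (by ring)⟩

end Reparametrization

section TwoToOne

namespace IsGenericallyTwoToOneAt

variable {X Y Z V : Type*} [TopologicalSpace X] [TopologicalSpace Y]

lemma of_involutive [T2Space X] {f : X → V} {p : X} {ι : X → X} (hι : Function.Involutive ι)
    (hcont : Continuous ι) (hp : ι p = p) (hdense : Dense {z | ι z ≠ z})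
    (hf : ∀ z w, f w = f z ↔ w = z ∨ w = ι z) : IsGenericallyTwoToOneAt f p := by
  intro N hN
  have hW : IsOpen (interior N ∩ ι ⁻¹' interior N) :=
    isOpen_interior.inter (isOpen_interior.preimage hcont)
  have hιW : ∀ z ∈ interior N ∩ ι ⁻¹' interior N, ι z ∈ interior N ∩ ι ⁻¹' interior N :=
    fun z hz => ⟨hz.2, by rw [mem_preimage, hι z]; exact hz.1⟩
  have hpN : p ∈ interior N := mem_interior_iff_mem_nhds.2 hN
  refine ⟨_, inter_subset_left.trans interior_subset, hW, ⟨hpN, by rwa [mem_preimage, hp]⟩,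
    _ ∩ {z | ι z ≠ z}, inter_subset_left, hW.inter (isOpen_ne_fun hcont continuous_id),
    hdense.open_subset_closure_inter hW, fun z ⟨hzW, hz⟩ => ncard_eq_two.2 ⟨z, ι z, hz.symm, ?_⟩⟩
  ext w
  simp only [hf, mem_ofPred_eq, mem_insert_iff, mem_singleton_iff, and_iff_right_iff_imp]
  rintro (rfl | rfl)
  exacts [hzW, hιW z hzW]

lemma of_openPartialHomeomorph {f : X → V} {g : Y → Z} {p : X} (S : OpenPartialHomeomorph X Y)
    (hp : p ∈ S.source) (hg : IsGenericallyTwoToOneAt g (S p)) {U : Set X} (hU : U ∈ 𝓝 p)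
    (hfg : ∀ z ∈ U, ∀ w ∈ U, f w = f z ↔ g (S w) = g (S z)) : IsGenericallyTwoToOneAt f p := by
  intro N hN
  have hSp : S p ∈ S.target := S.map_source hp
  have hNU : S.symm ⁻¹' (N ∩ U) ∈ 𝓝 (S p) :=
    S.symm.continuousAt hSp (by rw [S.left_inv hp]; exact inter_mem hN hU)
  obtain ⟨W, hWN, hWo, hpW, O, hOW, hOo, hWO, hcard⟩ :=
    hg _ (inter_mem (S.open_target.mem_nhds hSp) hNU)
  have hW : W ⊆ S.target := fun y hy => (hWN hy).1
  refine ⟨S.symm '' W, ?_, S.symm.isOpen_image_of_subset_source hWo hW,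
    ⟨S p, hpW, S.left_inv hp⟩, S.symm '' O, image_mono hOW,
    S.symm.isOpen_image_of_subset_source hOo (hOW.trans hW), ?_, ?_⟩
  · rintro _ ⟨y, hy, rfl⟩
    exact (hWN hy).2.1
  · rintro _ ⟨y, hy, rfl⟩
    exact (S.symm.continuousAt (hW hy)).continuousWithinAt.mem_closure_image (hWO hy)
  · rintro _ ⟨y, hy, rfl⟩
    have hfib : ∀ w ∈ W, f (S.symm w) = f (S.symm y) ↔ g w = g y := fun w hw => by
      rw [hfg _ (hWN (hOW hy)).2.2 _ (hWN hw).2.2, S.right_inv (hW hw),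
        S.right_inv (hW (hOW hy))]
    have himage : {x ∈ S.symm '' W | f x = f (S.symm y)} = S.symm '' {w ∈ W | g w = g y} := by
      ext x
      constructor
      · rintro ⟨⟨w, hw, rfl⟩, hfw⟩
        exact ⟨w, ⟨hw, (hfib w hw).1 hfw⟩, rfl⟩
      · rintro ⟨w, ⟨hw, hgw⟩, rfl⟩
        exact ⟨⟨w, hw, rfl⟩, (hfib w hw).2 hgw⟩
    rw [himage, (S.symm.injOn.mono fun w hw => hW hw.1).ncard_image, hcard y hy]

end IsGenericallyTwoToOneAt

variable {m : ℕ}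

lemma foldModel_eq_iff (hm : 2 ≤ m) (z w : ℝ × ℝ) :
    foldModel m w = foldModel m z ↔ w = z ∨ w = (z.1 + 2 * z.2, -z.2) := by
  constructor
  · intro h
    have h₀ : w.1 + w.2 = z.1 + z.2 := by
      simpa [foldModel] using congrArg (fun v : EuclideanSpace ℝ (Fin m) => v ⟨0, by omega⟩) h
    have h₁ : w.1 ^ 2 + 2 * w.2 * w.1 = z.1 ^ 2 + 2 * z.2 * z.1 := by
      simpa [foldModel] using congrArg (fun v : EuclideanSpace ℝ (Fin m) => v ⟨1, by omega⟩) h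
    -- `t² + 2st = (t + s)² - s²`
    have hsq : w.2 ^ 2 = z.2 ^ 2 := by linear_combination (w.1 + w.2 + z.1 + z.2) * h₀ - h₁
    exact (sq_eq_sq_iff_eq_or_eq_neg.1 hsq).imp
      (fun h₂ => Prod.ext (by linear_combination h₀ - h₂) h₂)
      fun h₂ => Prod.ext (by linear_combination h₀ - h₂) h₂
  · rintro (rfl | rfl)
    · rfl
    · have h₀ : z.1 + 2 * z.2 + -z.2 = z.1 + z.2 := by ring
      have h₁ : (z.1 + 2 * z.2) ^ 2 + 2 * -z.2 * (z.1 + 2 * z.2) = z.1 ^ 2 + 2 * z.2 * z.1 := by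
        ring
      simp only [foldModel, h₀, h₁]

lemma isGenericallyTwoToOneAt_foldModel (hm : 2 ≤ m) :
    IsGenericallyTwoToOneAt (foldModel m) (0 : ℝ × ℝ) := by
  refine .of_involutive (ι := fun z : ℝ × ℝ => (z.1 + 2 * z.2, -z.2))
    (fun z => by ext <;> simp) (by fun_prop) (by simp) ?_ (foldModel_eq_iff hm)
  have hfix : {z : ℝ × ℝ | (z.1 + 2 * z.2, -z.2) ≠ z} = univ ×ˢ {(0 : ℝ)}ᶜ := by
    ext z
    have hz : (z.1 + 2 * z.2, -z.2) = z ↔ z.2 = 0 := by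
      refine ⟨fun h => self_eq_neg.1 (Prod.ext_iff.1 h).2.symm, fun h => ?_⟩
      ext <;> simp [h]
    simpa using hz.not
  exact hfix ▸ dense_univ.prod (dense_compl_singleton 0)

lemma IsFoldAt.isGenericallyTwoToOneAt (hm : 2 ≤ m) {M : Type*} [TopologicalSpace M]
    [ChartedSpace (EuclideanSpace ℝ (Fin m)) M] {f : ℝ × ℝ → M} {p : ℝ × ℝ}
    (hf : IsFoldAt m f p) : IsGenericallyTwoToOneAt f p := by
  obtain ⟨hsmooth, σ, τ, ⟨S, hpS, hσS⟩, hσp, ⟨T, hpT, hτT⟩, -, hmodel⟩ := hf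
  have hS : S.toOpenPartialHomeomorph p = 0 := (hσS hpS).symm.trans hσp
  have hU : ∀ᶠ z in 𝓝 p, f z ∈ T.source ∧ τ (f z) = foldModel m (S z) := by
    filter_upwards [hsmooth.self_of_nhds.continuousAt (T.open_source.mem_nhds hpT), hmodel,
      S.open_source.mem_nhds hpS] with z hzT hz hzS
    exact ⟨hzT, hσS hzS ▸ hz⟩
  refine .of_openPartialHomeomorph S.toOpenPartialHomeomorph hpS
    (hS ▸ isGenericallyTwoToOneAt_foldModel hm) hU fun z hz w hw => ?_
  change f w = f z ↔ foldModel m (S w) = foldModel m (S z)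
  rw [← hz.2, ← hw.2, hτT hz.1, hτT hw.1]
  exact (T.injOn.eq_iff hw.1 hz.1).symm

end TwoToOne

section PlanarCurve

lemma SmoothNear.exists_graph {x y : ℝ → ℝ} {t₀ : ℝ} (hx : SmoothNear x t₀) (hy : SmoothNear y t₀)
    (hx' : deriv x t₀ ≠ 0) :
    ∃ h : ℝ → ℝ, SmoothNear h (x t₀) ∧ ∀ᶠ t in 𝓝 t₀, h (x t) = y t := by
  obtain ⟨e, hsrc, hcoe, -, hsymm⟩ := hx.exists_openPartialHomeomorph
    (hx.differentiableAt.hasDerivAt.hasFDerivAt_equiv hx')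
  have htgt : x t₀ ∈ e.target := hcoe t₀ ▸ e.map_source hsrc
  have hinv : ∀ t ∈ e.source, e.symm (x t) = t := fun t ht => hcoe t ▸ e.left_inv ht
  refine ⟨fun X => y (e.symm X), .comp (x t₀) ((hinv t₀ hsrc).symm ▸ hy)
    (.of_contDiffOn hsymm e.open_target htgt), ?_⟩
  filter_upwards [e.open_source.mem_nhds hsrc] with t ht
  rw [hinv t ht]

lemma sq_mul_integral_deriv_deriv {h : ℝ → ℝ} {X s : ℝ}
    (hh : ∀ θ ∈ Icc (0 : ℝ) 1, SmoothNear h (X + θ * s)) :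
    s ^ 2 * ∫ θ in (0 : ℝ)..1, (1 - θ) * deriv (deriv h) (X + θ * s) =
      h (X + s) - h X - s * deriv h X := by
  have hderiv : ∀ θ ∈ uIcc (0 : ℝ) 1, HasDerivAt
      (fun θ => h (X + θ * s) + (1 - θ) * s * deriv h (X + θ * s))
      (s ^ 2 * ((1 - θ) * deriv (deriv h) (X + θ * s))) θ := by
    intro θ hθ
    have hθh := hh θ (uIcc_of_le (zero_le_one (α := ℝ)) ▸ hθ)
    have hline : HasDerivAt (fun θ : ℝ => X + θ * s) s θ := by
      simpa using ((hasDerivAt_id θ).mul_const s).const_add X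
    have h₁ := hθh.differentiableAt.hasDerivAt.comp θ hline
    have h₂ := hθh.deriv.differentiableAt.hasDerivAt.comp θ hline
    refine (h₁.add ((((hasDerivAt_id θ).const_sub 1).mul_const s).mul h₂)).congr_deriv ?_
    simp only [Function.comp_apply, id]
    ring
  have hcont : ContinuousOn (fun θ => s ^ 2 * ((1 - θ) * deriv (deriv h) (X + θ * s)))
      (uIcc 0 1) := by
    refine continuousOn_const.mul (ContinuousOn.mul (by fun_prop) fun θ hθ => ?_)
    have hθh := hh θ (uIcc_of_le (zero_le_one (α := ℝ)) ▸ hθ)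
    exact (hθh.deriv.deriv.continuousAt.comp (f := fun θ => X + θ * s)
      (by fun_prop)).continuousWithinAt
  rw [← intervalIntegral.integral_const_mul,
    intervalIntegral.integral_eq_sub_of_hasDerivAt hderiv hcont.intervalIntegrable]
  simp only [one_mul, sub_self, zero_mul, add_zero, sub_zero]
  ring

lemma SmoothNear.exists_taylor_two {h : ℝ → ℝ} {a : ℝ} (hh : SmoothNear h a) :
    ∃ k : ℝ × ℝ → ℝ, SmoothNear k (a, 0) ∧ k (a, 0) = deriv (deriv h) a / 2 ∧
      ∀ᶠ z : ℝ × ℝ in 𝓝 (a, 0), z.2 ^ 2 * k z = h (z.1 + z.2) - h z.1 - z.2 * deriv h z.1 := by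
  refine ⟨fun z => ∫ θ in (0 : ℝ)..1, (1 - θ) * deriv (deriv h) (z.1 + θ * z.2), ?_, ?_, ?_⟩
  · refine SmoothNear.integral
      (k := fun p : (ℝ × ℝ) × ℝ => (1 - p.2) * deriv (deriv h) (p.1.1 + p.2 * p.1.2)) fun θ _ => ?_
    refine (of_contDiff (by fun_prop)).mul (comp (h := deriv (deriv h))
      (f := fun p : (ℝ × ℝ) × ℝ => p.1.1 + p.2 * p.1.2) _ ?_ (of_contDiff (by fun_prop)))
    simpa only [mul_zero, add_zero] using hh.deriv.deriv
  · have hint : ∫ θ in (0 : ℝ)..1, (1 - θ) = 1 / 2 := by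
      rw [intervalIntegral.integral_sub (by simp) (by simp)]
      norm_num
    simp only [mul_zero, add_zero, intervalIntegral.integral_mul_const, hint]
    ring
  · obtain ⟨ε, hε, hball⟩ := Metric.eventually_nhds_iff_ball.1 hh.eventually
    filter_upwards [prod_mem_nhds (Metric.ball_mem_nhds a (half_pos hε))
      (Metric.ball_mem_nhds (0 : ℝ) (half_pos hε))] with z ⟨hz₁, hz₂⟩
    refine sq_mul_integral_deriv_deriv fun θ hθ => hball _ ?_
    rw [mem_ball_zero_iff] at hz₂
    calc dist (z.1 + θ * z.2) a ≤ dist z.1 a + ‖θ * z.2‖ := by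
          rw [dist_eq_norm, dist_eq_norm, add_sub_right_comm]; exact norm_add_le _ _
      _ ≤ dist z.1 a + ‖z.2‖ := by
          rw [norm_mul, Real.norm_of_nonneg hθ.1]
          gcongr
          exact mul_le_of_le_one_left (norm_nonneg _) hθ.2
      _ < ε := by linarith [Metric.mem_ball.1 hz₁]

end PlanarCurve

section FoldNormalForm

variable {t₀ : ℝ}

lemma SmoothNear.isLocalDiffeomorphAt {E F : Type*} [NormedAddCommGroup E] [NormedSpace ℝ E]
    [CompleteSpace E] [NormedAddCommGroup F] [NormedSpace ℝ F] {f : E → F} {a : E}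
    (hf : SmoothNear f a) {e : E ≃L[ℝ] F} (he : HasFDerivAt f (e : E →L[ℝ] F) a) :
    IsLocalDiffeomorphAt 𝓘(ℝ, E) 𝓘(ℝ, F) ∞ f a := by
  obtain ⟨h, ha, hcoe, hsmooth, hsymm⟩ := hf.exists_openPartialHomeomorph he
  exact ⟨{ h with
      contMDiffOn_toFun := hsmooth.contMDiffOn
      contMDiffOn_invFun := hsymm.contMDiffOn }, ha, fun x _ => (hcoe x).symm⟩

lemma SmoothNear.exists_sq_eq_taylor_remainder {h : ℝ → ℝ} {a : ℝ} (hh : SmoothNear h a)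
    (hpos : 0 < deriv (deriv h) a) :
    ∃ (β : ℝ × ℝ → ℝ) (c : ℝ), SmoothNear β (a, 0) ∧ c ≠ 0 ∧
      HasFDerivAt β (c • ContinuousLinearMap.snd ℝ ℝ ℝ) (a, 0) ∧ β (a, 0) = 0 ∧
      ∀ᶠ z : ℝ × ℝ in 𝓝 (a, 0), β z ^ 2 = h (z.1 + z.2) - h z.1 - z.2 * deriv h z.1 := by
  obtain ⟨k, hk, hka, hk_taylor⟩ := hh.exists_taylor_two
  have hk_pos : ∀ᶠ z in 𝓝 (a, 0), 0 < k z :=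
    hk.continuousAt.eventually (lt_mem_nhds (hka ▸ half_pos hpos))
  have hsqrt : SmoothNear (fun z => √(k z)) (a, 0) := by
    filter_upwards [hk, hk_pos] with z hz hz_pos using hz.sqrt hz_pos.ne'
  refine ⟨fun z => z.2 * √(k z), √(k (a, 0)), (of_contDiff contDiff_snd).mul hsqrt,
    (Real.sqrt_pos.2 hk_pos.self_of_nhds).ne',
    (hasFDerivAt_snd.mul hsqrt.differentiableAt.hasFDerivAt).congr_fderiv (by simp),
    zero_mul _, ?_⟩
  filter_upwards [hk_taylor, hk_pos] with z hz hz_pos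
  rw [mul_pow, Real.sq_sqrt hz_pos.le, hz]

lemma eventually_deriv_graph {x y h : ℝ → ℝ} (hx : SmoothNear x t₀) (hh : SmoothNear h (x t₀))
    (hgraph : ∀ᶠ t in 𝓝 t₀, h (x t) = y t) :
    ∀ᶠ t in 𝓝 t₀, deriv h (x t) * deriv x t = deriv y t := by
  filter_upwards [hx.continuousAt.eventually hh.eventually, hx.eventually,
    eventually_eventually_nhds.2 hgraph] with t hht hxt ht
  rw [← EventuallyEq.deriv_eq ht]
  exact (hht.differentiableAt.hasDerivAt.comp t hxt.differentiableAt.hasDerivAt).deriv.symm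

lemma deriv_deriv_graph {x y h : ℝ → ℝ} (hx : SmoothNear x t₀) (hh : SmoothNear h (x t₀))
    (hgraph : ∀ᶠ t in 𝓝 t₀, h (x t) = y t) (hx' : deriv x t₀ = 1) (hy' : deriv y t₀ = 0) :
    deriv (deriv h) (x t₀) = deriv (deriv y) t₀ := by
  have hgraph' := eventually_deriv_graph hx hh hgraph
  have hh' : deriv h (x t₀) = 0 := by
    simpa only [hx', mul_one, hy'] using hgraph'.self_of_nhds
  rw [← EventuallyEq.deriv_eq hgraph']
  refine (((hh.deriv.differentiableAt.hasDerivAt.comp t₀ hx.differentiableAt.hasDerivAt).mul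
    hx.deriv.differentiableAt.hasDerivAt).deriv.trans ?_).symm
  simp only [Function.comp_apply, hx', hh', mul_one, zero_mul, add_zero]

/-- The continuous linear automorphism `(t, s) ↦ (t + s - c s, c s)` of the plane. -/
noncomputable def foldCoordEquiv {c : ℝ} (hc : c ≠ 0) : (ℝ × ℝ) ≃L[ℝ] ℝ × ℝ :=
  .equivOfInverse
    ((ContinuousLinearMap.fst ℝ ℝ ℝ + ContinuousLinearMap.snd ℝ ℝ ℝ -
      c • ContinuousLinearMap.snd ℝ ℝ ℝ).prod (c • ContinuousLinearMap.snd ℝ ℝ ℝ))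
    ((ContinuousLinearMap.fst ℝ ℝ ℝ + ContinuousLinearMap.snd ℝ ℝ ℝ -
      c⁻¹ • ContinuousLinearMap.snd ℝ ℝ ℝ).prod (c⁻¹ • ContinuousLinearMap.snd ℝ ℝ ℝ))
    (fun z => by ext <;> simp [hc]) (fun z => by ext <;> simp [hc])

lemma SmoothNear.comp_fst {E : Type*} [NormedAddCommGroup E] [NormedSpace ℝ E] {g : ℝ → E}
    (hg : SmoothNear g t₀) : SmoothNear (fun z : ℝ × ℝ => g z.1) (t₀, 0) :=
  .comp (t₀, (0 : ℝ)) hg (of_contDiff contDiff_fst)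

lemma hasFDerivAt_tangentCoords {x : ℝ → ℝ} {r : ℝ × ℝ → ℝ} (hx : SmoothNear x t₀)
    (hx' : deriv x t₀ = 1) (hr : SmoothNear r (t₀, 0)) (hr₀ : ∀ᶠ t in 𝓝 t₀, r (t, 0) = 0)
    (hr' : HasDerivAt (fun s => r (t₀, s)) 1 0) :
    HasFDerivAt (fun z : ℝ × ℝ => (x z.1, r z * deriv x z.1)) (.id ℝ (ℝ × ℝ)) (t₀, 0) := by
  have hT : HasFDerivAt (fun z : ℝ × ℝ => x z.1) (ContinuousLinearMap.fst ℝ ℝ ℝ) (t₀, 0) :=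
    ((hx' ▸ hx.differentiableAt.hasDerivAt :).comp_hasFDerivAt ((t₀, 0) : ℝ × ℝ)
      hasFDerivAt_fst).congr_fderiv (by simp)
  have hR : HasFDerivAt (fun z : ℝ × ℝ => r z * deriv x z.1) (ContinuousLinearMap.snd ℝ ℝ ℝ)
      (t₀, 0) :=
    ((hasFDerivAt_of_eventually_eq_zero_on_axis hr.differentiableAt hr₀ hr').mul
      hx.deriv.comp_fst.differentiableAt.hasFDerivAt).congr_fderiv
      (by simp [hr₀.self_of_nhds, hx'])
  exact (hT.prodMk hR).congr_fderiv (by ext <;> simp)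

/- The tangent lines of the graph of `h` stay at vertical distance `β²` below the graph, so that
`σ = (x + r x' - β, β)` brings `(X, Y + X² - h X)` into the form `(a + b, (a + b)² - b²)`. -/
lemma exists_fold_coordinates {x y : ℝ → ℝ} {r : ℝ × ℝ → ℝ} (hx : SmoothNear x t₀)
    (hy : SmoothNear y t₀) (hx₀ : x t₀ = 0) (hy₀ : y t₀ = 0) (hx' : deriv x t₀ = 1)
    (hy' : deriv y t₀ = 0) (hy'' : 0 < deriv (deriv y) t₀) (hr : SmoothNear r (t₀, 0))
    (hr₀ : ∀ᶠ t in 𝓝 t₀, r (t, 0) = 0) (hr' : HasDerivAt (fun s => r (t₀, s)) 1 0) :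
    ∃ (P : ℝ → ℝ) (σ : ℝ × ℝ → ℝ × ℝ), SmoothNear P 0 ∧ P 0 = 0 ∧
      IsLocalDiffeomorphAt 𝓘(ℝ, ℝ × ℝ) 𝓘(ℝ, ℝ × ℝ) ∞ σ (t₀, 0) ∧ σ (t₀, 0) = 0 ∧
      ∀ᶠ z : ℝ × ℝ in 𝓝 (t₀, 0), (σ z).1 + (σ z).2 = x z.1 + r z * deriv x z.1 ∧
        (σ z).1 ^ 2 + 2 * (σ z).2 * (σ z).1 =
          y z.1 + r z * deriv y z.1 + P (x z.1 + r z * deriv x z.1) := by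
  obtain ⟨h, hh, hgraph⟩ := hx.exists_graph hy (hx' ▸ one_ne_zero)
  obtain ⟨β, c, hβ, hc, hβ', hβ₀, hβsq⟩ := hh.exists_sq_eq_taylor_remainder
    (deriv_deriv_graph hx hh hgraph hx' hy' ▸ hy'')
  rw [hx₀] at hβ hβ' hβ₀ hβsq
  let C : ℝ × ℝ → ℝ × ℝ := fun z => (x z.1, r z * deriv x z.1)
  have hC : SmoothNear C (t₀, 0) := hx.comp_fst.prodMk (hr.mul hx.deriv.comp_fst)
  have hC₀ : C (t₀, 0) = (0, 0) := by simp only [C, hx₀, hr₀.self_of_nhds, zero_mul]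
  have hσ : SmoothNear (fun w : ℝ × ℝ => (w.1 + w.2 - β w, β w)) (C (t₀, 0)) := by
    rw [hC₀]
    exact ((SmoothNear.of_contDiff (contDiff_fst.add contDiff_snd)).sub hβ).prodMk hβ
  have hσ' : HasFDerivAt (fun w : ℝ × ℝ => (w.1 + w.2 - β w, β w))
      (foldCoordEquiv hc : (ℝ × ℝ) →L[ℝ] ℝ × ℝ) (C (t₀, 0)) := by
    rw [hC₀]
    exact ((hasFDerivAt_fst.add hasFDerivAt_snd).sub hβ').prodMk hβ'
  have hh₀ : h 0 = 0 := by simpa only [hx₀, hy₀] using hgraph.self_of_nhds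
  refine ⟨fun X => X ^ 2 - h X, fun z => ((C z).1 + (C z).2 - β (C z), β (C z)),
    (SmoothNear.of_contDiff (by fun_prop)).sub (hx₀ ▸ hh), by simp [hh₀],
    (SmoothNear.comp _ hσ hC).isLocalDiffeomorphAt (e := foldCoordEquiv hc)
      (hσ'.comp _ (hasFDerivAt_tangentCoords hx hx' hr hr₀ hr')),
    by simp [hC₀, hβ₀], ?_⟩
  have hC_tendsto : Tendsto C (𝓝 (t₀, 0)) (𝓝 (0, 0)) := hC₀ ▸ hC.continuousAt.tendsto
  have hfst : Tendsto (Prod.fst : ℝ × ℝ → ℝ) (𝓝 (t₀, 0)) (𝓝 t₀) := continuous_fst.continuousAt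
  filter_upwards [hC_tendsto.eventually hβsq, hfst.eventually hgraph,
    hfst.eventually (eventually_deriv_graph hx hh hgraph)] with z hz_sq hz hz'
  refine ⟨sub_add_cancel _ _, ?_⟩
  simp only [C, hz] at hz_sq ⊢
  linear_combination -hz_sq + r z * hz'

end FoldNormalForm

section LinearAlgebra

variable {K V : Type*} [Field K] [AddCommGroup V] [Module K V]

lemma mem_span_pair_of_not_linearIndependent {u v w : V} (huv : LinearIndependent K ![u, v])
    (huvw : ¬ LinearIndependent K ![u, v, w]) : w ∈ Submodule.span K {u, v} := by
  by_contra hw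
  refine huvw ?_
  rw [show ![u, v, w] = (Fin.snoc ![u, v] w : Fin 3 → V) by ext i; fin_cases i <;> rfl]
  exact linearIndependent_finSnoc.2 ⟨huv, by rwa [Matrix.range_cons_cons_empty]⟩

lemma exists_linearEquiv_apply_eq [FiniteDimensional K V] {ι : Type*} {v w : ι → V}
    (hv : LinearIndependent K v) (hw : LinearIndependent K w) :
    ∃ e : V ≃ₗ[K] V, ∀ i, e (v i) = w i := by
  obtain ⟨e, he⟩ := Submodule.exists_linearEquiv_restrict_eq
    (hv.linearCombinationEquiv.symm ≪≫ₗ hw.linearCombinationEquiv)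
  refine ⟨e, fun i => ?_⟩
  have hi := he (hv.linearCombinationEquiv (Finsupp.single i 1))
  simp only [LinearEquiv.trans_apply, LinearEquiv.symm_apply_apply,
    LinearIndependent.linearCombinationEquiv_apply_coe, Finsupp.linearCombination_single,
    one_smul] at hi
  exact hi.symm

end LinearAlgebra

section OsculatingPlane

variable {E F : Type*} [NormedAddCommGroup E] [NormedSpace ℝ E] [NormedAddCommGroup F]
    [NormedSpace ℝ F] {t₀ : ℝ}

lemma eventuallyEq_zero_of_hasDerivAt_clm_apply {y : ℝ → E} {A : ℝ → E →L[ℝ] E}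
    (hA : ContinuousAt A t₀) (hy : ∀ᶠ t in 𝓝 t₀, HasDerivAt y (A t (y t)) t) (hy₀ : y t₀ = 0) :
    y =ᶠ[𝓝 t₀] 0 := by
  have hlip : ∀ᶠ t in 𝓝 t₀, LipschitzOnWith (‖A t₀‖₊ + 1) (A t) univ := by
    filter_upwards [hA.nnnorm.eventually_lt_const (lt_add_one _)] with t ht
    exact ((A t).lipschitz.weaken ht.le).lipschitzOnWith
  exact ODE_solution_unique_of_eventually (v := fun t => A t) (s := fun _ => univ) hlip
    (hy.mono fun t ht => ⟨ht, mem_univ _⟩)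
    (.of_forall fun t => ⟨by simp, mem_univ _⟩) hy₀

/- Cramer's rule, with the functionals `φ` and `ψ` as coordinates. -/
lemma exists_continuousAt_coeff_of_mem_span_pair {u v w : ℝ → E} (hu : ContinuousAt u t₀)
    (hv : ContinuousAt v t₀) (hw : ContinuousAt w t₀) (φ ψ : E →L[ℝ] ℝ)
    (hdet : φ (u t₀) * ψ (v t₀) - φ (v t₀) * ψ (u t₀) ≠ 0)
    (hmem : ∀ᶠ t in 𝓝 t₀, w t ∈ Submodule.span ℝ {u t, v t}) :
    ∃ a b : ℝ → ℝ, ContinuousAt a t₀ ∧ ContinuousAt b t₀ ∧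
      ∀ᶠ t in 𝓝 t₀, w t = a t • u t + b t • v t := by
  let D : ℝ → ℝ := fun t => φ (u t) * ψ (v t) - φ (v t) * ψ (u t)
  have hD : ContinuousAt D t₀ := by fun_prop
  refine ⟨fun t => (φ (w t) * ψ (v t) - φ (v t) * ψ (w t)) / D t,
    fun t => (φ (u t) * ψ (w t) - φ (w t) * ψ (u t)) / D t,
    .div (by fun_prop) hD hdet, .div (by fun_prop) hD hdet, ?_⟩
  filter_upwards [hmem, hD.eventually_ne hdet] with t ht hDt
  obtain ⟨a, b, hab⟩ := Submodule.mem_span_pair.1 ht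
  rw [← hab]
  congr 2 <;> rw [eq_div_iff hDt] <;>
    simp only [map_add, map_smul, smul_eq_mul, D] <;> ring

lemma SmoothNear.eventually_hasDerivAt_clm {g : ℝ → E} (hg : SmoothNear g t₀) (L : E →L[ℝ] F) :
    ∀ᶠ t in 𝓝 t₀, HasDerivAt (fun τ => L (g τ)) (L (deriv g t)) t :=
  hg.eventually.mono fun t ht =>
    L.hasFDerivAt.comp_hasDerivAt t ht.differentiableAt.hasDerivAt

lemma SmoothNear.deriv_clm_comp {g : ℝ → E} (hg : SmoothNear g t₀) (L : E →L[ℝ] F) :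
    deriv (fun τ => L (g τ)) =ᶠ[𝓝 t₀] fun t => L (deriv g t) :=
  (hg.eventually_hasDerivAt_clm L).mono fun _ h => h.deriv

lemma eventually_clm_apply_eq_zero {g : ℝ → E} (hg : SmoothNear g t₀) {a b : ℝ → ℝ}
    (ha : ContinuousAt a t₀) (hb : ContinuousAt b t₀)
    (hode : ∀ᶠ t in 𝓝 t₀, deriv (deriv (deriv g)) t = a t • deriv g t + b t • deriv (deriv g) t)
    (L : E →L[ℝ] F) (hL : L (g t₀) = 0) (hL' : L (deriv g t₀) = 0)
    (hL'' : L (deriv (deriv g) t₀) = 0) : ∀ᶠ t in 𝓝 t₀, L (g t) = 0 := by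
  let y₁ : F × F × F →L[ℝ] F := .comp (.fst ℝ F F) (.snd ℝ F (F × F))
  let y₂ : F × F × F →L[ℝ] F := .comp (.snd ℝ F F) (.snd ℝ F (F × F))
  let incl : F →L[ℝ] F × F × F := .comp (.inr ℝ F (F × F)) (.inr ℝ F F)
  let A : ℝ → F × F × F →L[ℝ] F × F × F := fun t =>
    y₁.prod (y₂.prod 0) + a t • incl.comp y₁ + b t • incl.comp y₂
  have hA : ContinuousAt A t₀ := by fun_prop
  have hy : ∀ᶠ t in 𝓝 t₀,
      HasDerivAt (fun t => (L (g t), L (deriv g t), L (deriv (deriv g) t)))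
        (A t (L (g t), L (deriv g t), L (deriv (deriv g) t))) t := by
    filter_upwards [hg.eventually_hasDerivAt_clm L, hg.deriv.eventually_hasDerivAt_clm L,
      hg.deriv.deriv.eventually_hasDerivAt_clm L, hode] with t h₀ h₁ h₂ ht
    convert h₀.prodMk (h₁.prodMk h₂) using 1
    simp [A, y₁, y₂, incl, ht]
  filter_upwards [eventuallyEq_zero_of_hasDerivAt_clm_apply hA hy
    (by simp only [hL, hL', hL'', Prod.mk_zero_zero])] with t ht using congrArg Prod.fst ht

variable {m : ℕ}

local notation "𝔼" => EuclideanSpace ℝ (Fin m)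

lemma linearIndependent_single_pair {i j : Fin m} (hij : i ≠ j) :
    LinearIndependent ℝ ![(EuclideanSpace.single i 1 : 𝔼), EuclideanSpace.single j 1] := by
  refine LinearIndependent.pair_iff.2 fun a b hab => ⟨?_, ?_⟩
  · simpa [hij] using congrArg (fun v : 𝔼 => v i) hab
  · simpa [hij.symm] using congrArg (fun v : 𝔼 => v j) hab

lemma eventually_mem_osculating_plane {G : ℝ → 𝔼} {i j : Fin m} (hij : i ≠ j)
    (hG : SmoothNear G t₀) (hG₀ : G t₀ = 0) (hG₁ : deriv G t₀ = EuclideanSpace.single i 1)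
    (hG₂ : deriv (deriv G) t₀ = EuclideanSpace.single j 1)
    (hG₃ : ∀ᶠ t in 𝓝 t₀, deriv (deriv (deriv G)) t ∈
      Submodule.span ℝ {deriv G t, deriv (deriv G) t}) :
    ∀ᶠ t in 𝓝 t₀, G t = G t i • EuclideanSpace.single i 1 + G t j • EuclideanSpace.single j 1 := by
  obtain ⟨a, b, ha, hb, hode⟩ := exists_continuousAt_coeff_of_mem_span_pair
    hG.deriv.continuousAt hG.deriv.deriv.continuousAt hG.deriv.deriv.deriv.continuousAt
    (EuclideanSpace.proj i) (EuclideanSpace.proj j) (by simp [hG₁, hG₂, hij]) hG₃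
  have hzero : ∀ᶠ t in 𝓝 t₀, ∀ k, k ≠ i → k ≠ j → G t k = 0 := by
    simp only [eventually_all]
    intro k hki hkj
    exact eventually_clm_apply_eq_zero hG ha hb hode (EuclideanSpace.proj k)
      (by simp [hG₀]) (by simp [hG₁, hki]) (by simp [hG₂, hkj])
  filter_upwards [hzero] with t ht
  ext k
  rcases eq_or_ne k i with rfl | hki
  · simp [hij]
  rcases eq_or_ne k j with rfl | hkj
  · simp [hki]
  · simp [hki, hkj, ht k hki hkj]

lemma exists_plane_coordinates {G : ℝ → 𝔼} {i j : Fin m} (hij : i ≠ j)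
    (hG : SmoothNear G t₀) (hG₀ : G t₀ = 0) (hG₁ : deriv G t₀ = EuclideanSpace.single i 1)
    (hG₂ : deriv (deriv G) t₀ = EuclideanSpace.single j 1)
    (hG₃ : ∀ᶠ t in 𝓝 t₀, deriv (deriv (deriv G)) t ∈
      Submodule.span ℝ {deriv G t, deriv (deriv G) t}) :
    ∃ x y : ℝ → ℝ, SmoothNear x t₀ ∧ SmoothNear y t₀ ∧ x t₀ = 0 ∧ y t₀ = 0 ∧
      deriv x t₀ = 1 ∧ deriv y t₀ = 0 ∧ deriv (deriv y) t₀ = 1 ∧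
      ∀ᶠ t in 𝓝 t₀, G t = x t • EuclideanSpace.single i 1 + y t • EuclideanSpace.single j 1 := by
  have hsmooth (k : Fin m) : SmoothNear (fun t => G t k) t₀ :=
    .comp t₀ (.of_contDiff (EuclideanSpace.proj (𝕜 := ℝ) k).contDiff) hG
  have hderiv (k : Fin m) : deriv (fun t => G t k) =ᶠ[𝓝 t₀] fun t => deriv G t k :=
    hG.deriv_clm_comp (EuclideanSpace.proj k)
  have hderiv' : deriv (deriv fun t => G t j) t₀ = deriv (deriv G) t₀ j :=
    (hderiv j).deriv_eq.trans (hG.deriv.deriv_clm_comp (EuclideanSpace.proj j)).eq_of_nhds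
  exact ⟨fun t => G t i, fun t => G t j, hsmooth i, hsmooth j, by simp [hG₀], by simp [hG₀],
    by simp [(hderiv i).eq_of_nhds, hG₁], by simp [(hderiv j).eq_of_nhds, hG₁, hij.symm],
    by simp [hderiv', hG₂], eventually_mem_osculating_plane hij hG hG₀ hG₁ hG₂ hG₃⟩

lemma exists_osculating_coordinates {g : ℝ → 𝔼} {i j : Fin m} (hij : i ≠ j)
    (hg : SmoothNear g t₀) (hind : LinearIndependent ℝ ![deriv g t₀, deriv (deriv g) t₀])
    (hdep : ∀ᶠ t in 𝓝 t₀, deriv (deriv (deriv g)) t ∈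
      Submodule.span ℝ {deriv g t, deriv (deriv g) t}) :
    ∃ (Λ : 𝔼 ≃L[ℝ] 𝔼) (x y : ℝ → ℝ), SmoothNear x t₀ ∧ SmoothNear y t₀ ∧
      x t₀ = 0 ∧ y t₀ = 0 ∧ deriv x t₀ = 1 ∧ deriv y t₀ = 0 ∧ deriv (deriv y) t₀ = 1 ∧
      ∀ᶠ t in 𝓝 t₀, Λ (g t - g t₀) =
        x t • EuclideanSpace.single i 1 + y t • EuclideanSpace.single j 1 := by
  obtain ⟨Λ', hΛ'⟩ := exists_linearEquiv_apply_eq hind (linearIndependent_single_pair hij)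
  let Λ : 𝔼 ≃L[ℝ] 𝔼 := Λ'.toContinuousLinearEquiv
  let G : ℝ → 𝔼 := fun t => Λ (g t - g t₀)
  have hG₀ : SmoothNear (fun t => g t - g t₀) t₀ := hg.sub (.of_contDiff contDiff_const)
  have hG : SmoothNear G t₀ := .comp t₀ (.of_contDiff Λ.contDiff) hG₀
  have hG' : deriv G =ᶠ[𝓝 t₀] fun t => Λ (deriv g t) :=
    (hG₀.deriv_clm_comp (Λ : 𝔼 →L[ℝ] 𝔼)).trans (.of_forall fun t => by simp)
  have hG'' : deriv (deriv G) =ᶠ[𝓝 t₀] fun t => Λ (deriv (deriv g) t) :=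
    hG'.deriv.trans (hg.deriv.deriv_clm_comp (Λ : 𝔼 →L[ℝ] 𝔼))
  have hG''' : deriv (deriv (deriv G)) =ᶠ[𝓝 t₀] fun t => Λ (deriv (deriv (deriv g)) t) :=
    hG''.deriv.trans (hg.deriv.deriv.deriv_clm_comp (Λ : 𝔼 →L[ℝ] 𝔼))
  refine ⟨Λ, exists_plane_coordinates hij hG (by simp) (hG'.eq_of_nhds.trans (hΛ' 0))
    (hG''.eq_of_nhds.trans (hΛ' 1)) ?_⟩
  filter_upwards [hG', hG'', hG''', hdep] with t h₁ h₂ h₃ ht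
  obtain ⟨a, b, hab⟩ := Submodule.mem_span_pair.1 ht
  exact Submodule.mem_span_pair.2 ⟨a, b, by rw [h₁, h₂, h₃, ← hab, map_add, map_smul, map_smul]⟩

lemma isLocalDiffeomorphAt_shear {P : ℝ → ℝ} (hP : SmoothNear P 0) {i j : Fin m} (hij : i ≠ j) :
    IsLocalDiffeomorphAt 𝓘(ℝ, 𝔼) 𝓘(ℝ, 𝔼) ∞
      (fun z : 𝔼 => z + P (z i) • EuclideanSpace.single j (1 : ℝ)) 0 := by
  let N : 𝔼 →L[ℝ] 𝔼 :=
    (deriv P 0 • EuclideanSpace.proj (𝕜 := ℝ) i).smulRight (EuclideanSpace.single j 1)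
  have hcoord : SmoothNear (fun z : 𝔼 => z i) 0 :=
    .of_contDiff (EuclideanSpace.proj (𝕜 := ℝ) i).contDiff
  have hsmooth : SmoothNear (fun z : 𝔼 => z + P (z i) • EuclideanSpace.single j (1 : ℝ)) 0 :=
    (SmoothNear.of_contDiff contDiff_id).add
      ((SmoothNear.comp (0 : 𝔼) (h := P) hP hcoord).smul (.of_contDiff contDiff_const))
  have hderiv : HasDerivAt P (deriv P 0) ((0 : 𝔼) i) := hP.differentiableAt.hasDerivAt
  refine hsmooth.isLocalDiffeomorphAt (e := .equivOfInverse (.id ℝ 𝔼 + N) (.id ℝ 𝔼 - N)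
    (fun z => by simp [N, hij]) (fun z => by simp [N, hij])) ?_
  exact (hasFDerivAt_id _).add ((hderiv.comp_hasFDerivAt (0 : 𝔼)
    (EuclideanSpace.proj (𝕜 := ℝ) i : 𝔼 →L[ℝ] ℝ).hasFDerivAt).smul_const _)

lemma foldModel_eq_add_smul_single (hm : 2 ≤ m) (z : ℝ × ℝ) :
    foldModel m z = (z.1 + z.2) • EuclideanSpace.single ⟨0, by lia⟩ 1 +
      (z.1 ^ 2 + 2 * z.2 * z.1) • EuclideanSpace.single ⟨1, by lia⟩ 1 := by
  ext k
  rcases k with ⟨_ | _ | k, hk⟩ <;> simp [foldModel]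

lemma eventually_clm_deriv_eq {g : ℝ → E} {x y : ℝ → ℝ} (hg : SmoothNear g t₀)
    (hx : SmoothNear x t₀) (hy : SmoothNear y t₀) {Λ : E →L[ℝ] F} {c : E} {u v : F}
    (hΛ : ∀ᶠ t in 𝓝 t₀, Λ (g t - c) = x t • u + y t • v) :
    ∀ᶠ t in 𝓝 t₀, Λ (deriv g t) = deriv x t • u + deriv y t • v := by
  filter_upwards [hΛ.eventually_nhds, hg.eventually, hx.eventually, hy.eventually]
    with t ht hgt hxt hyt
  have hΛg : HasDerivAt (fun t => Λ (g t - c)) (Λ (deriv g t)) t :=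
    Λ.hasFDerivAt.comp_hasDerivAt t (hgt.differentiableAt.hasDerivAt.sub_const c)
  have hxy : HasDerivAt (fun t => x t • u + y t • v) (deriv x t • u + deriv y t • v) t :=
    (hxt.differentiableAt.hasDerivAt.smul_const u).add
      (hyt.differentiableAt.hasDerivAt.smul_const v)
  exact (hΛg.congr_of_eventuallyEq (EventuallyEq.symm ht)).unique hxy

lemma exists_foldModel_eq (hm : 2 ≤ m) {g : ℝ → 𝔼} (hg : SmoothNear g t₀)
    (hind : LinearIndependent ℝ ![deriv g t₀, deriv (deriv g) t₀])
    (hdep : ∀ᶠ t in 𝓝 t₀, deriv (deriv (deriv g)) t ∈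
      Submodule.span ℝ {deriv g t, deriv (deriv g) t})
    {r : ℝ × ℝ → ℝ} (hr : SmoothNear r (t₀, 0)) (hr₀ : ∀ᶠ t in 𝓝 t₀, r (t, 0) = 0)
    (hr' : HasDerivAt (fun s => r (t₀, s)) 1 0) :
    ∃ (σ : ℝ × ℝ → ℝ × ℝ) (τ : 𝔼 → 𝔼),
      IsLocalDiffeomorphAt 𝓘(ℝ, ℝ × ℝ) 𝓘(ℝ, ℝ × ℝ) ∞ σ (t₀, 0) ∧ σ (t₀, 0) = 0 ∧
      IsLocalDiffeomorphAt 𝓘(ℝ, 𝔼) 𝓘(ℝ, 𝔼) ∞ τ (g t₀) ∧ τ (g t₀) = 0 ∧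
      ∀ᶠ z : ℝ × ℝ in 𝓝 (t₀, 0), τ (g z.1 + r z • deriv g z.1) = foldModel m (σ z) := by
  have hij : (⟨0, by lia⟩ : Fin m) ≠ ⟨1, by lia⟩ := by simp
  obtain ⟨Λ, x, y, hx, hy, hx₀, hy₀, hx', hy', hy'', hΛ⟩ :=
    exists_osculating_coordinates hij hg hind hdep
  obtain ⟨P, σ, hP, hP₀, hσ, hσ₀, hfold⟩ := exists_fold_coordinates hx hy hx₀ hy₀ hx' hy'
    (hy'' ▸ one_pos) hr hr₀ hr'
  let shear : 𝔼 → 𝔼 := fun z => z + P (z ⟨0, by lia⟩) • EuclideanSpace.single ⟨1, by lia⟩ 1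
  have hΛ_diffeo : IsLocalDiffeomorphAt 𝓘(ℝ, 𝔼) 𝓘(ℝ, 𝔼) ∞ (fun z => Λ (z - g t₀)) (g t₀) :=
    SmoothNear.isLocalDiffeomorphAt
      (.of_contDiff (Λ.contDiff.comp (contDiff_id.sub contDiff_const)))
      (e := Λ) ((Λ : 𝔼 →L[ℝ] 𝔼).hasFDerivAt.comp _ ((hasFDerivAt_id _).sub_const _))
  have hshear : IsLocalDiffeomorphAt 𝓘(ℝ, 𝔼) 𝓘(ℝ, 𝔼) ∞ shear (Λ (g t₀ - g t₀)) := by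
    simpa using isLocalDiffeomorphAt_shear hP hij
  refine ⟨σ, shear ∘ fun z => Λ (z - g t₀), hσ, hσ₀, hΛ_diffeo.comp _ _ hshear,
    by simp [shear, hP₀], ?_⟩
  have hfst : Tendsto (Prod.fst : ℝ × ℝ → ℝ) (𝓝 (t₀, 0)) (𝓝 t₀) := continuous_fst.continuousAt
  have hΛ' := eventually_clm_deriv_eq (Λ := (Λ : 𝔼 →L[ℝ] 𝔼)) hg hx hy hΛ
  filter_upwards [hfold, hfst.eventually hΛ, hfst.eventually hΛ'] with z hz hgz hgz'
  have hsplit : Λ (g z.1 + r z • deriv g z.1 - g t₀) =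
      (x z.1 + r z * deriv x z.1) • EuclideanSpace.single ⟨0, by lia⟩ 1 +
        (y z.1 + r z * deriv y z.1) • EuclideanSpace.single ⟨1, by lia⟩ 1 := by
    rw [add_sub_right_comm, map_add, map_smul, hgz, ← Λ.coe_coe, hgz']
    module
  rw [foldModel_eq_add_smul_single hm, hz.1, hz.2]
  simp only [Function.comp_apply, shear, hsplit]
  simp [add_smul, add_assoc]

end OsculatingPlane

section TangentSurface

variable {m : ℕ} {M : Type*} [TopologicalSpace M] [ChartedSpace (EuclideanSpace ℝ (Fin m)) M]

local notation "𝔼" => EuclideanSpace ℝ (Fin m)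

lemma SmoothNear.exists_smul_eq {X V : Type*} [NormedAddCommGroup X] [NormedSpace ℝ X]
    [NormedAddCommGroup V] [InnerProductSpace ℝ V] {u w : X → V} {a : X} (hu : SmoothNear u a)
    (hw : SmoothNear w a) (ha : u a ≠ 0) (hwu : ∀ᶠ z in 𝓝 a, ∃ l : ℝ, w z = l • u z) :
    ∃ κ : X → ℝ, SmoothNear κ a ∧ ∀ᶠ z in 𝓝 a, w z = κ z • u z := by
  have hne : ∀ᶠ z in 𝓝 a, u z ≠ 0 := hu.continuousAt.eventually_ne ha
  refine ⟨fun z => inner ℝ (w z) (u z) / inner ℝ (u z) (u z), ?_, ?_⟩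
  · filter_upwards [hu, hw, hne] with z huz hwz hz
      using (hwz.inner ℝ huz).div (huz.inner ℝ huz) (inner_self_ne_zero.2 hz)
  · filter_upwards [hwu, hne] with z ⟨l, hl⟩ hz
    rw [hl, real_inner_smul_left, mul_div_assoc, div_self (inner_self_ne_zero.2 hz), mul_one]

lemma hasDerivAt_line_spray {E : Type*} [NormedAddCommGroup E] [NormedSpace ℝ E]
    {Γ : E → E →L[ℝ] E →L[ℝ] E} {y v : E} {ρ ρ₁ : ℝ → ℝ} {k s : ℝ}
    (hΓ : Γ (y + ρ s • v) v v = k • v) (hρ : HasDerivAt ρ (ρ₁ s) s)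
    (hρ₁ : HasDerivAt ρ₁ (-(k * ρ₁ s ^ 2)) s) :
    HasDerivAt (fun s => (y + ρ s • v, ρ₁ s • v)) (spray Γ (y + ρ s • v, ρ₁ s • v)) s := by
  have hspray : spray Γ (y + ρ s • v, ρ₁ s • v) = (ρ₁ s • v, (-(k * ρ₁ s ^ 2)) • v) := by
    refine Prod.ext rfl ?_
    simp only [spray, map_smul, smul_apply, hΓ]
    module
  rw [hspray]
  exact ((hρ.smul_const v).const_add y).prodMk (hρ₁.smul_const v)

namespace SmoothChart

variable (Ψ : SmoothChart m M)

lemma totalSpace_ext {p p' : TangentBundle (𝓡 m) M} (hp : p.proj ∈ Ψ.source)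
    (hproj : p.proj = p'.proj) (hv : Ψ.differential p.proj p.2 = Ψ.differential p'.proj p'.2) :
    p = p' := by
  obtain ⟨x, v⟩ := p
  obtain ⟨x', v'⟩ := p'
  obtain rfl : x = x' := hproj
  obtain rfl : v = v' := (Ψ.isInvertible_differential hp).injective hv
  rfl

variable [IsManifold (𝓡 m) ∞ M] [T2Space M]
  {cov : CovariantDerivative (𝓡 m) (EuclideanSpace ℝ (Fin m)) (TangentSpace (𝓡 m) : M → Type _)}
  [CovariantDerivative.ContMDiffCovariantDerivative cov ∞]

lemma geodesicMap_eq_symm {p : TangentBundle (𝓡 m) M} (hp : p.proj ∈ Ψ.source) {J : Set ℝ}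
    (hJ : IsOpen J) (hJ' : J.OrdConnected) (h0 : (0 : ℝ) ∈ J) {α : ℝ → 𝔼 × 𝔼}
    (hα₀ : α 0 = (Ψ p.proj, Ψ.differential p.proj p.2)) (hαJ : ∀ s ∈ J, (α s).1 ∈ Ψ.target)
    (hα : ∀ s ∈ J, HasDerivAt α (spray (Ψ.christoffel cov) (α s)) s) {s : ℝ} (hs : s ∈ J) :
    geodesicMap cov p s = Ψ.symm (α s).1 := by
  have hgeo := Ψ.isGeodesicCurveOn_symm_comp hJ hαJ hα
  have hproj : Ψ.symm (α 0).1 = p.proj := by rw [hα₀, Ψ.symm_apply_apply hp]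
  have hvel : deriv (fun s => Ψ (Ψ.symm (α s).1)) 0 = Ψ.differential p.proj p.2 := by
    have hpos : ∀ s ∈ J, Ψ (Ψ.symm (α s).1) = (α s).1 := fun s hs => Ψ.right_inv (hαJ s hs)
    refine (EventuallyEq.deriv_eq (eventually_of_mem (hJ.mem_nhds h0) hpos)).trans
      ((hasFDerivAt_fst.comp_hasDerivAt 0 (hα 0 h0)).deriv.trans ?_)
    rw [hα₀]
    rfl
  have hsrc₀ : Ψ.symm (α 0).1 ∈ Ψ.source := hproj ▸ hp
  refine Ψ.geodesicMap_eq (c := fun s => Ψ.symm (α s).1)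
    ⟨hJ, hJ', h0, hgeo, Ψ.totalSpace_ext hsrc₀ hproj ?_⟩ (fun s hs => Ψ.map_target (hαJ s hs)) hs
  exact (Ψ.differential_curveVelocity ((eventually_contMDiffAt hJ hgeo.smooth
    h0).self_of_nhds.mdifferentiableAt (by simp)) hsrc₀).trans hvel

lemma geodesicMap_eq_symm_line {p : TangentBundle (𝓡 m) M} (hp : p.proj ∈ Ψ.source) {J : Set ℝ}
    (hJ : IsOpen J) (hJ' : J.OrdConnected) (h0 : (0 : ℝ) ∈ J) {y v : 𝔼} (hy : Ψ p.proj = y)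
    (hv : Ψ.differential p.proj p.2 = v) {k ρ ρ₁ : ℝ → ℝ} (hρ₀ : ρ 0 = 0) (hρ₁₀ : ρ₁ 0 = 1)
    (htarget : ∀ s ∈ J, y + ρ s • v ∈ Ψ.target)
    (hk : ∀ s ∈ J, Ψ.christoffel cov (y + ρ s • v) v v = k s • v)
    (hρ : ∀ s ∈ J, HasDerivAt ρ (ρ₁ s) s)
    (hρ₁ : ∀ s ∈ J, HasDerivAt ρ₁ (-(k s * ρ₁ s ^ 2)) s) {s : ℝ} (hs : s ∈ J) :
    geodesicMap cov p s = Ψ.symm (y + ρ s • v) :=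
  Ψ.geodesicMap_eq_symm hp hJ hJ' h0 (α := fun s => (y + ρ s • v, ρ₁ s • v))
    (by simp [hy, hv, hρ₀, hρ₁₀]) htarget
    (fun s hs => hasDerivAt_line_spray (hk s hs) (hρ s hs) (hρ₁ s hs)) hs

namespace MapsGeodesicsToLines

variable {Ψ}

lemma exists_smoothNear_christoffel_eq_smul (hΨ : Ψ.MapsGeodesicsToLines cov) {X : Type*}
    [NormedAddCommGroup X] [NormedSpace ℝ X] {y v : X → 𝔼} {a : X} (hy : SmoothNear y a)
    (hv : SmoothNear v a) (hya : y a ∈ Ψ.target) (hva : v a ≠ 0) :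
    ∃ κ : X → ℝ, SmoothNear κ a ∧
      ∀ᶠ z in 𝓝 a, Ψ.christoffel cov (y z) (v z) (v z) = κ z • v z := by
  have htarget : ∀ᶠ z in 𝓝 a, y z ∈ Ψ.target :=
    hy.continuousAt.eventually (Ψ.open_target.mem_nhds hya)
  refine hv.exists_smul_eq ?_ hva
    (htarget.mono fun z hz => hΨ.exists_christoffel_self_eq_smul hz (v z))
  filter_upwards [hy, hv, htarget] with z hyz hvz hz
  exact (((Ψ.contDiffAt_christoffel cov hz).comp z hyz).clm_apply hvz).clm_apply hvz

lemma exists_geodesic_parametrization (hΨ : Ψ.MapsGeodesicsToLines cov) {g : ℝ → 𝔼} {t₀ : ℝ}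
    (hg : SmoothNear g t₀) (htarget : g t₀ ∈ Ψ.target) (hne : deriv g t₀ ≠ 0) :
    ∃ r r₁ k : ℝ × ℝ → ℝ, SmoothNear r (t₀, 0) ∧ (∀ᶠ t in 𝓝 t₀, r (t, 0) = 0 ∧ r₁ (t, 0) = 1) ∧
      ∀ᶠ z : ℝ × ℝ in 𝓝 (t₀, 0), g z.1 + r z • deriv g z.1 ∈ Ψ.target ∧
        Ψ.christoffel cov (g z.1 + r z • deriv g z.1) (deriv g z.1) (deriv g z.1) =
          k z • deriv g z.1 ∧
        HasDerivAt (fun s => r (z.1, s)) (r₁ z) z.2 ∧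
        HasDerivAt (fun s => r₁ (z.1, s)) (-(k z * r₁ z ^ 2)) z.2 := by
  have hline : ∀ {ρ : ℝ × ℝ → ℝ}, SmoothNear ρ (t₀, 0) →
      SmoothNear (fun z => g z.1 + ρ z • deriv g z.1) (t₀, 0) := fun hρ =>
    hg.comp_fst.add (hρ.smul hg.deriv.comp_fst)
  have hbase : ∀ {ρ : ℝ}, ρ = 0 → g t₀ + ρ • deriv g t₀ ∈ Ψ.target := by
    rintro _ rfl
    simpa only [zero_smul, add_zero] using htarget
  obtain ⟨κ, hκ, hκ_eq⟩ := hΨ.exists_smoothNear_christoffel_eq_smul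
    (hline (.of_contDiff contDiff_snd)) hg.deriv.comp_fst (hbase rfl) hne
  obtain ⟨r, r₁, hr, hr₀, hr'⟩ := hκ.exists_affine_reparametrization
  have hr_base : r (t₀, 0) = 0 := hr₀.self_of_nhds.1
  have hpull : Tendsto (fun z : ℝ × ℝ => (z.1, r z)) (𝓝 (t₀, 0)) (𝓝 (t₀, 0)) := by
    simpa only [ContinuousAt, hr_base] using
      (continuous_fst.continuousAt (x := ((t₀, 0) : ℝ × ℝ))).prodMk hr.continuousAt
  exact ⟨r, r₁, fun z => κ (z.1, r z), hr, hr₀,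
    ((hline hr).continuousAt.eventually (Ψ.open_target.mem_nhds (hbase hr_base))).and
      ((hpull.eventually hκ_eq).and hr')⟩

lemma exists_tangentSurface_eq (hΨ : Ψ.MapsGeodesicsToLines cov) {γ : ℝ → M} {t₀ : ℝ}
    (hγ : ∀ᶠ t in 𝓝 t₀, ContMDiffAt 𝓘(ℝ, ℝ) (𝓡 m) ∞ γ t) (hsrc : γ t₀ ∈ Ψ.source)
    (hne : deriv (fun t => Ψ (γ t)) t₀ ≠ 0) :
    ∃ r : ℝ × ℝ → ℝ, SmoothNear r (t₀, 0) ∧ (∀ᶠ t in 𝓝 t₀, r (t, 0) = 0) ∧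
      HasDerivAt (fun s => r (t₀, s)) 1 0 ∧ ∀ᶠ z : ℝ × ℝ in 𝓝 (t₀, 0),
        Ψ (γ z.1) + r z • deriv (fun t => Ψ (γ t)) z.1 ∈ Ψ.target ∧
        tangentSurface cov γ z = Ψ.symm (Ψ (γ z.1) + r z • deriv (fun t => Ψ (γ t)) z.1) := by
  obtain ⟨r, r₁, k, hr, hr₀, hr'⟩ := hΨ.exists_geodesic_parametrization
    (Ψ.smoothNear_comp hγ hsrc) (Ψ.map_source hsrc) hne
  have hr_one : HasDerivAt (fun s => r (t₀, s)) 1 0 := by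
    simpa only [hr₀.self_of_nhds.2] using hr'.self_of_nhds.2.2.1
  refine ⟨r, hr, hr₀.mono fun t ht => ht.1, hr_one, ?_⟩
  obtain ⟨δ, hδ, hball⟩ := Metric.eventually_nhds_iff_ball.1 hr'
  rw [← ball_prod_same] at hball
  have hsource : ∀ᶠ t in 𝓝 t₀, γ t ∈ Ψ.source :=
    hγ.self_of_nhds.continuousAt.eventually (Ψ.open_source.mem_nhds hsrc)
  have hfst : Tendsto (Prod.fst : ℝ × ℝ → ℝ) (𝓝 (t₀, 0)) (𝓝 t₀) := continuous_fst.continuousAt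
  filter_upwards [Metric.ball_mem_nhds _ hδ, hfst.eventually hr₀, hfst.eventually hsource,
    hfst.eventually (Ψ.eventually_differential_curveVelocity hγ hsrc)] with z hz hrz hsrcz hvelz
  rw [← ball_prod_same] at hz
  have hray := fun s (hs : s ∈ Metric.ball (0 : ℝ) δ) => hball (z.1, s) ⟨hz.1, hs⟩
  exact ⟨(hball z hz).1, Ψ.geodesicMap_eq_symm_line (p := ⟨γ z.1, curveVelocity γ z.1⟩)
    (ρ := fun s => r (z.1, s)) hsrcz Metric.isOpen_ball
    (convex_ball _ _).ordConnected (Metric.mem_ball_self hδ) rfl hvelz hrz.1 hrz.2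
    (fun s hs => (hray s hs).1) (fun s hs => (hray s hs).2.1) (fun s hs => (hray s hs).2.2.1)
    (fun s hs => (hray s hs).2.2.2) hz.2⟩

end MapsGeodesicsToLines

end SmoothChart

end TangentSurface

section Torsionless

variable {m : ℕ} {M : Type*} [TopologicalSpace M] [ChartedSpace (EuclideanSpace ℝ (Fin m)) M]

local notation "𝔼" => EuclideanSpace ℝ (Fin m)

variable [IsManifold (𝓡 m) ∞ M] [T2Space M]
  {cov : CovariantDerivative (𝓡 m) (EuclideanSpace ℝ (Fin m)) (TangentSpace (𝓡 m) : M → Type _)}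
  [CovariantDerivative.ContMDiffCovariantDerivative cov ∞]

namespace SmoothChart.MapsGeodesicsToLines

variable {Ψ : SmoothChart m M} {γ : ℝ → M} {t : ℝ}

lemma exists_differential_iterCovDeriv_one (hΨ : Ψ.MapsGeodesicsToLines cov)
    (hγ : ∀ᶠ τ in 𝓝 t, ContMDiffAt 𝓘(ℝ, ℝ) (𝓡 m) ∞ γ τ) (hsrc : γ t ∈ Ψ.source)
    (hv : (curveVelocity γ t : TangentSpace (𝓡 m) (γ t)) ≠ 0) :
    ∃ κ : ℝ → ℝ, SmoothNear κ t ∧ ∀ᶠ τ in 𝓝 t,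
      Ψ.differential (γ τ) (iterCovDeriv cov γ 1 τ) =
        deriv (deriv fun t => Ψ (γ t)) τ + κ τ • deriv (fun t => Ψ (γ t)) τ := by
  have hg := Ψ.smoothNear_comp hγ hsrc
  have hne : deriv (fun t => Ψ (γ t)) t ≠ 0 := by
    rw [← Ψ.differential_curveVelocity (hγ.self_of_nhds.mdifferentiableAt (by simp)) hsrc]
    exact (map_ne_zero_iff _ (Ψ.isInvertible_differential hsrc).injective).2 hv
  obtain ⟨κ, hκ, hκ_eq⟩ := hΨ.exists_smoothNear_christoffel_eq_smul hg hg.deriv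
    (Ψ.map_source hsrc) hne
  have hsource : ∀ᶠ τ in 𝓝 t, γ τ ∈ Ψ.source :=
    hγ.self_of_nhds.continuousAt.eventually (Ψ.open_source.mem_nhds hsrc)
  refine ⟨κ, hκ, ?_⟩
  filter_upwards [hκ_eq, hγ.eventually_nhds, hsource] with τ hκτ hγτ hτ
  rw [← hκτ]
  exact Ψ.differential_covDerivAlong_curveVelocity cov hγτ hτ

lemma linearIndependent_deriv_pair (hΨ : Ψ.MapsGeodesicsToLines cov)
    (hγ : ∀ᶠ τ in 𝓝 t, ContMDiffAt 𝓘(ℝ, ℝ) (𝓡 m) ∞ γ τ) (hsrc : γ t ∈ Ψ.source)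
    (hind : LinearIndependent ℝ ![iterCovDeriv cov γ 0 t, iterCovDeriv cov γ 1 t]) :
    LinearIndependent ℝ ![deriv (fun t => Ψ (γ t)) t, deriv (deriv fun t => Ψ (γ t)) t] := by
  have hγt := hγ.self_of_nhds.mdifferentiableAt (by simp)
  obtain ⟨κ, -, hacc⟩ := hΨ.exists_differential_iterCovDeriv_one hγ hsrc (hind.ne_zero 0)
  have himage := hind.map' (Ψ.differential (γ t)).toLinearMap
    (LinearMap.ker_eq_bot.2 (Ψ.isInvertible_differential hsrc).injective)
  rw [← LinearIndependent.pair_add_smul_right_iff (c := κ t), add_comm, ← hacc.self_of_nhds,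
    ← Ψ.differential_curveVelocity hγt hsrc]
  convert himage using 1
  ext1 i
  fin_cases i <;> rfl

lemma deriv_deriv_deriv_mem_span (hΨ : Ψ.MapsGeodesicsToLines cov) (htorsion : cov.torsion = 0)
    (hγ : ∀ᶠ τ in 𝓝 t, ContMDiffAt 𝓘(ℝ, ℝ) (𝓡 m) ∞ γ τ) (hsrc : γ t ∈ Ψ.source)
    (hind : LinearIndependent ℝ ![iterCovDeriv cov γ 0 t, iterCovDeriv cov γ 1 t])
    (hdep : ¬ LinearIndependent ℝ
      ![iterCovDeriv cov γ 0 t, iterCovDeriv cov γ 1 t, iterCovDeriv cov γ 2 t]) :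
    deriv (deriv (deriv fun t => Ψ (γ t))) t ∈
      Submodule.span ℝ {deriv (fun t => Ψ (γ t)) t, deriv (deriv fun t => Ψ (γ t)) t} := by
  have hγt := hγ.self_of_nhds.mdifferentiableAt (by simp)
  obtain ⟨κ, hκ, hacc⟩ := hΨ.exists_differential_iterCovDeriv_one hγ hsrc (hind.ne_zero 0)
  have hvel : Ψ.differential (γ t) (iterCovDeriv cov γ 0 t) = deriv (fun t => Ψ (γ t)) t :=
    Ψ.differential_curveVelocity hγt hsrc
  generalize hg_def : (fun t => Ψ (γ t)) = g at *
  have hg : SmoothNear g t := hg_def ▸ Ψ.smoothNear_comp hγ hsrc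
  have hderiv : HasDerivAt (fun τ => deriv (deriv g) τ + κ τ • deriv g τ)
      (deriv (deriv (deriv g)) t + (κ t • deriv (deriv g) t + deriv κ t • deriv g t)) t :=
    hg.deriv.deriv.differentiableAt.hasDerivAt.add
      (hκ.differentiableAt.hasDerivAt.smul hg.deriv.differentiableAt.hasDerivAt)
  obtain ⟨a, b, hΓ⟩ := hΨ.exists_christoffel_eq_add htorsion (Ψ.map_source hsrc) (deriv g t)
    (deriv (deriv g) t + κ t • deriv g t)
  have hjerk := Ψ.differential_covDerivAlong cov hsrc hγt (iterCovDeriv cov γ 1)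
    hderiv.differentiableAt hacc
  rw [hderiv.deriv, show Ψ.differential (γ t) (curveVelocity γ t) = deriv g t from hvel, hΓ]
    at hjerk
  obtain ⟨c, d, hcd⟩ := Submodule.mem_span_pair.1 (mem_span_pair_of_not_linearIndependent hind hdep)
  have hdep' := congrArg (Ψ.differential (γ t)) hcd
  rw [map_add, map_smul, map_smul, hvel, hacc.self_of_nhds] at hdep'
  refine Submodule.mem_span_pair.2
    ⟨c + d * κ t - deriv κ t - a - b * κ t, d - κ t - b, ?_⟩
  linear_combination (norm := module) hdep'.trans hjerk

end SmoothChart.MapsGeodesicsToLines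

end Torsionless

section FoldTransport

variable {m : ℕ}

local notation "𝔼" => EuclideanSpace ℝ (Fin m)

lemma isFoldAt_tangentLines (hm : 2 ≤ m) {g : ℝ → 𝔼} {t₀ : ℝ} (hg : SmoothNear g t₀)
    (hind : LinearIndependent ℝ ![deriv g t₀, deriv (deriv g) t₀])
    (hdep : ∀ᶠ t in 𝓝 t₀, deriv (deriv (deriv g)) t ∈
      Submodule.span ℝ {deriv g t, deriv (deriv g) t})
    {r : ℝ × ℝ → ℝ} (hr : SmoothNear r (t₀, 0)) (hr₀ : ∀ᶠ t in 𝓝 t₀, r (t, 0) = 0)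
    (hr' : HasDerivAt (fun s => r (t₀, s)) 1 0) :
    IsFoldAt m (fun z => g z.1 + r z • deriv g z.1) (t₀, 0) := by
  obtain ⟨σ, τ, hσ, hσ₀, hτ, hτ₀, hfold⟩ := exists_foldModel_eq hm hg hind hdep hr hr₀ hr'
  have hsmooth : SmoothNear (fun z => g z.1 + r z • deriv g z.1) (t₀, 0) :=
    hg.comp_fst.add (hr.smul hg.deriv.comp_fst)
  have hbase : g t₀ + r (t₀, 0) • deriv g t₀ = g t₀ := by
    rw [hr₀.self_of_nhds, zero_smul, add_zero]
  rw [← hbase] at hτ hτ₀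
  exact ⟨hsmooth.mono fun z hz => hz.contMDiffAt, σ, τ, hσ, hσ₀, hτ, hτ₀, hfold⟩

lemma SmoothChart.isFoldAt_of_eventually_eq_symm {M : Type*} [TopologicalSpace M]
    [ChartedSpace (EuclideanSpace ℝ (Fin m)) M] (Ψ : SmoothChart m M) {f : ℝ × ℝ → M}
    {h : ℝ × ℝ → 𝔼} {p : ℝ × ℝ} (hh : IsFoldAt m h p)
    (hf : ∀ᶠ z in 𝓝 p, h z ∈ Ψ.target ∧ f z = Ψ.symm (h z)) : IsFoldAt m f p := by
  obtain ⟨hsmooth, σ, τ, hσ, hσp, hτ, hτp, hfold⟩ := hh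
  obtain ⟨htarget, hfp⟩ := hf.self_of_nhds
  have hΨ : ∀ {y : 𝔼}, y ∈ Ψ.target → Ψ (Ψ.symm y) = y := fun hy => Ψ.right_inv hy
  refine ⟨?_, σ, τ ∘ Ψ, hσ, hσp, ?_, ?_, ?_⟩
  · filter_upwards [hsmooth, hf.eventually_nhds] with z hz hfz
    exact ((Ψ.contMDiffAt_symm hfz.self_of_nhds.1).comp z hz).congr_of_eventuallyEq
      (hfz.mono fun w hw => hw.2)
  · rw [hfp]
    exact IsLocalDiffeomorphAt.comp _ _ ⟨Ψ, Ψ.map_target htarget, fun _ _ => rfl⟩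
      ((hΨ htarget).symm ▸ hτ)
  · rw [hfp, Function.comp_apply, hΨ htarget, hτp]
  · filter_upwards [hf, hfold] with z hz hfoldz
    rw [hz.2, Function.comp_apply, hΨ hz.1, hfoldz]

end FoldTransport

theorem proposition12p3_general {m : ℕ}
    {M : Type*} [TopologicalSpace M] [T2Space M]
    [ChartedSpace (EuclideanSpace ℝ (Fin m)) M] [IsManifold (𝓡 m) ∞ M]
    (cov : CovariantDerivative (𝓡 m) (EuclideanSpace ℝ (Fin m)) (TangentSpace (𝓡 m) : M → Type _))
    [CovariantDerivative.ContMDiffCovariantDerivative cov ∞]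
    (htorsion : cov.torsion = 0)
    (q : M) (hflat : IsProjectivelyFlatAround cov q)
    (γ : ℝ → M) (J : Set ℝ) (hJ : IsOpen J) (t₀ : ℝ) (ht₀ : t₀ ∈ J) (hq : γ t₀ = q)
    (hγ : IsTorsionlessOn cov γ J) :
    tangentSurface cov γ (t₀, 0) = q ∧
    IsFoldAt m (tangentSurface cov γ) (t₀, 0) ∧
    IsGenericallyTwoToOneAt (tangentSurface cov γ) (t₀, 0) := by
  obtain ⟨Ψ, hqΨ, hΨ⟩ := SmoothChart.exists_mapsGeodesicsToLines hflat
  subst hq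
  have hsmooth {t : ℝ} (ht : t ∈ J) := eventually_contMDiffAt hJ hγ.smooth ht
  have hind := hΨ.linearIndependent_deriv_pair (hsmooth ht₀) hqΨ (hγ.indep t₀ ht₀)
  have hdep : ∀ᶠ t in 𝓝 t₀, deriv (deriv (deriv fun t => Ψ (γ t))) t ∈
      Submodule.span ℝ {deriv (fun t => Ψ (γ t)) t, deriv (deriv fun t => Ψ (γ t)) t} := by
    filter_upwards [hJ.mem_nhds ht₀, (hsmooth ht₀).self_of_nhds.continuousAt.eventually
      (Ψ.open_source.mem_nhds hqΨ)] with t ht htΨ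
    exact hΨ.deriv_deriv_deriv_mem_span htorsion (hsmooth ht) htΨ (hγ.indep t ht) (hγ.dep t ht)
  have hm : 2 ≤ m := by simpa using hind.fintype_card_le_finrank
  obtain ⟨r, hr, hr₀, hr', hsurface⟩ :=
    hΨ.exists_tangentSurface_eq (hsmooth ht₀) hqΨ (hind.ne_zero 0)
  have hbase : tangentSurface cov γ (t₀, 0) = γ t₀ := by
    rw [hsurface.self_of_nhds.2, hr₀.self_of_nhds, zero_smul, add_zero, Ψ.symm_apply_apply hqΨ]
  have hfold : IsFoldAt m (tangentSurface cov γ) (t₀, 0) :=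
    Ψ.isFoldAt_of_eventually_eq_symm (isFoldAt_tangentLines hm
      (Ψ.smoothNear_comp (hsmooth ht₀) hqΨ) hind hdep hr hr₀ hr') hsurface
  exact ⟨hbase, hfold, hfold.isGenericallyTwoToOneAt hm⟩

theorem proposition12p3 {m : ℕ} (hm : 3 ≤ m)
    {M : Type*} [TopologicalSpace M] [T2Space M]
    [ChartedSpace (EuclideanSpace ℝ (Fin m)) M] [IsManifold (𝓡 m) ∞ M]
    (cov : CovariantDerivative (𝓡 m) (EuclideanSpace ℝ (Fin m)) (TangentSpace (𝓡 m) : M → Type _))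
    [CovariantDerivative.ContMDiffCovariantDerivative cov ∞]
    (htorsion : cov.torsion = 0)
    (q : M) (hflat : IsProjectivelyFlatAround cov q)
    (γ : ℝ → M) (J : Set ℝ) (hJ : IsOpen J) (t₀ : ℝ) (ht₀ : t₀ ∈ J) (hq : γ t₀ = q)
    (hγ : IsTorsionlessOn cov γ J) :
    tangentSurface cov γ (t₀, 0) = q ∧
    IsFoldAt m (tangentSurface cov γ) (t₀, 0) ∧
    IsGenericallyTwoToOneAt (tangentSurface cov γ) (t₀, 0) :=
  proposition12p3_general cov htorsion q hflat γ J hJ t₀ ht₀ hq hγ
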